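/- Let $\mathbb H,\mathbb U$ be (real or complex) Hilbert spaces, let $(S(t))_{t\in\mathbb R}$ be a strongly continuous group on $\mathbb H$ with infinitesimal generator $(A,\mathcal D(A))$, and write $e^{tA}=S(t)$, $e^{-tA^*}=S(-t)^*$. Equip $\mathcal D(A^*)$ with the scalar product $\langle z_1,z_2\rangle_{\mathbb H}+\langle A^*z_1,A^*z_2\rangle_{\mathbb H}$, and let $\mathcal D(A^*)'$ be its dual with respect to the pivot space $\mathbb H$. Let $B\in\mathcal L(\mathbb U,\mathcal D(A^*)')$ be an admissible control operator: for all $T>0$ and $u\in L^2((0,T);\mathbb U)$, the function $t\mapsto\int_0^tS(t-s)Bu(s)\,ds$ belongs to $C([0,T];\mathbb H)$. Let $\lambda,\lambda_1\in\mathbb R$. Let $Q\in\mathcal L(\mathbb H)$ be symmetric, invertible and positive (i.e. $\langle Qx,x\rangle\ge\kappa\|x\|^2$ for all $x \in \mathbb H$, for some $\kappa>0$), and let $W\in\mathcal L(\mathbb U)$ be symmetric and non-negative. Assume that $AQ+QA^*-BWB^*+2\lambda Q=0$, in the sense that $$\langle Qx,A^*y\rangle_{\mathbb H}+\langle A^*x,Qy\rangle_{\mathbb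 H}-\langle WB^*x,B^*y\rangle_{\mathbb U}+2\lambda\langle Qx,y\rangle_{\mathbb H}=0\qquad\forall\,x,y\in\mathcal D(A^*).$$ For $y_0,\widetilde y_0\in\mathbb H$ consider the system $$\begin{cases}y'=Ay-BWB^*\widetilde y,\\ \widetilde y'=-A^*\widetilde y-2\lambda\widetilde y+\lambda_1Q^{-1}(y-Q\widetilde y),\\ y(0)=y_0,\quad\widetilde y(0)=\widetilde y_0.\end{cases}\qquad(*)$$ A weak solution of $(*)$ on $[0,T]$ is a pair $(y,\widetilde y)\in C([0,T];\mathbb H)^2$ satisfying the initial conditions and, in the sense of distributions on $(0,T)$, $$\tfrac{d}{dt}\langle y,\varphi\rangle=\langle y,A^*\varphi\rangle-\langle WB^*\widetilde y,B^*\varphi\rangle_{\mathbb U}\quad\forall\,\varphi\in\mathcal D(A^*),$$ $$\tfrac{d}{dt}\langle\widetilde y,\psi\rangle=-\langle\widetilde y,A\psi\rangle+\langle g,\psi\rangle\quad\forall\,\psi\in\mathcal D(A),\qquad g:=-2\lambda\widetilde y+\lambda_1Q^{-1}(y-Q\widetilde y).$$ Here $B^*\widetilde y\in L^2((0,T);\mathbb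 U)$ is defined by density: it is the limit in $L^2((0,T);\mathbb U)$ of $B^*z_n$, where $z_n\in C([0,T];\mathcal D(A^*))$ is the weak solution of $z_n'=-A^*z_n+g_n$ with $z_n(0)\in\mathcal D(A^*)$, $g_n\in C([0,T];\mathcal D(A^*))$, $z_n(0)\to\widetilde y(0)$ in $\mathbb H$ and $g_n\to g$ in $L^1((0,T);\mathbb H)$. A weak solution on $[0,\infty)$ is a pair which is a weak solution on $[0,T]$ for every $T>0$. Then: 1. For all $y_0,\widetilde y_0\in\mathbb H$, system $(*)$ has a weak solution on $[0,\infty)$, and for every $T>0$ its weak solution on $[0,T]$ is unique. 2. Let $\hat\omega_0(A),\hat\omega_0(-A^*)\in\mathbb R$ and $c>0$ be such that $\|e^{tA}\|\le ce^{t\hat\omega_0(A)}$ and $\|e^{-tA^*}\|\le ce^{t\hat\omega_0(-A^*)}$ for all $t\ge0$. If $\lambda_1-2\lambda>\hat\omega_0(A)-\hat\omega_0(-A^*)$, then there is $C>0$, independent of $t$ and of $(y_0,\widetilde y_0)$, such that the weak solution on $[0,\infty)$ satisfies $$\|y(t)\|_{\mathbb H}+\|\widetilde y(t)\|_{\mathbb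 H}\le Ce^{(\hat\omega_0(-A^*)-2\lambda)t}\big(\|y_0\|_{\mathbb H}+\|\widetilde y_0\|_{\mathbb H}\big)\qquad\forall\,t\ge0.$$ 3. If $A$ is skew-adjoint ($A^*=-A$, with equality of domains) and $\lambda_1>2\lambda$, then there is $C>0$, independent of $t$ and of $(y_0,\widetilde y_0)$, such that $$\|y(t)\|_{\mathbb H}+\|\widetilde y(t)\|_{\mathbb H}\le Ce^{-2\lambda t}\big(\|y_0\|_{\mathbb H}+\|\widetilde y_0\|_{\mathbb H}\big)\qquad\forall\,t\ge0.$$ -/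

import Mathlib

noncomputable section

/-- A strongly continuous group `(S(t))_{t ∈ ℝ}` of bounded linear operators on `H`. -/
structure C0Group (𝕜 H : Type*) [RCLike 𝕜] [NormedAddCommGroup H] [InnerProductSpace 𝕜 H] where
  /-- The operator `S(t)`. -/
  op : ℝ → H →L[𝕜] H
  op_zero : op 0 = ContinuousLinearMap.id 𝕜 H
  op_add : ∀ t₁ t₂ : ℝ, op (t₁ + t₂) = (op t₁).comp (op t₂)
  tendsto_zero : ∀ x : H, Filter.Tendsto (fun t => op t x) (nhds 0) (nhds x)

namespace C0Group

variable {𝕜 H : Type*} [RCLike 𝕜] [NormedAddCommGroup H] [InnerProductSpace 𝕜 H]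

/-- The graph of the infinitesimal generator: the pairs `(x, w)` such that
`(S(t) x - x) / t → w` as `t → 0`. -/
def generatorGraph (S : C0Group 𝕜 H) : Submodule 𝕜 (H × H) where
  carrier := {p | Filter.Tendsto (fun t : ℝ => ((t⁻¹ : ℝ) : 𝕜) • (S.op t p.1 - p.1))
    (nhdsWithin 0 {0}ᶜ) (nhds p.2)}
  zero_mem' := by simp
  add_mem' := by
    intro p q hp hq
    simp only [Set.mem_ofPred_eq] at *
    refine (hp.add hq).congr fun t => ?_
    simp only [Prod.fst_add, map_add, ← smul_add]
    congr 1
    abel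
  smul_mem' := by
    intro c p hp
    simp only [Set.mem_ofPred_eq] at *
    refine (hp.const_smul c).congr fun t => ?_
    simp only [Prod.smul_fst, map_smul, ← smul_sub]
    rw [smul_comm]

/-- The infinitesimal generator `(A, D(A))` of the group. -/
def generator (S : C0Group 𝕜 H) : H →ₗ.[𝕜] H := S.generatorGraph.toLinearPMap

theorem mem_generatorGraph (S : C0Group 𝕜 H) (p : H × H) :
    p ∈ S.generatorGraph ↔
      Filter.Tendsto (fun t : ℝ => ((t⁻¹ : ℝ) : 𝕜) • (S.op t p.1 - p.1))
        (nhdsWithin 0 {0}ᶜ) (nhds p.2) := Iff.rfl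

theorem generator_graph (S : C0Group 𝕜 H) : S.generator.graph = S.generatorGraph := by
  refine Submodule.toLinearPMap_graph_eq _ fun p hp h0 => ?_
  rw [mem_generatorGraph, h0] at hp
  simp only [map_zero, sub_zero, smul_zero] at hp
  exact tendsto_nhds_unique hp tendsto_const_nhds

theorem op_mem_generatorGraph (S : C0Group 𝕜 H) (s : ℝ) {p : H × H}
    (hp : p ∈ S.generatorGraph) : (S.op s p.1, S.op s p.2) ∈ S.generatorGraph := by
  rw [mem_generatorGraph] at *
  refine (((S.op s).continuous.tendsto _).comp hp).congr fun t => ?_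
  have h : S.op s (S.op t p.1) = S.op t (S.op s p.1) := by
    have h1 := S.op_add s t
    rw [add_comm, S.op_add] at h1
    exact (DFunLike.congr_fun h1 p.1).symm
  simp [h]

theorem continuous_op (S : C0Group 𝕜 H) (x : H) : Continuous fun t => S.op t x := by
  rw [continuous_iff_continuousAt]
  intro s
  have h1 : Filter.Tendsto (fun t : ℝ => t - s) (nhds s) (nhds 0) := by
    have : Filter.Tendsto (fun t : ℝ => t - s) (nhds s) (nhds (s - s)) :=
      (continuous_id.sub continuous_const).tendsto s
    rwa [sub_self] at this
  refine (((S.op s).continuous.tendsto x).comp ((S.tendsto_zero x).comp h1)).congr fun t => ?_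
  have h2 := DFunLike.congr_fun (S.op_add s (t - s)) x
  rw [add_sub_cancel] at h2
  exact h2.symm

theorem dense_generator_domain [CompleteSpace H] (S : C0Group 𝕜 H) :
    Dense (S.generator.domain : Set H) := by
  let _ : NormedSpace ℝ H := NormedSpace.restrictScalars ℝ 𝕜 H
  have hsm : ∀ (r : ℝ) (v : H), r • v = (r : 𝕜) • v := fun r v => rfl
  intro x
  let G : ℝ → H := fun t => ∫ s in (0 : ℝ)..t, S.op s x
  have hc := S.continuous_op x
  have hG : ∀ t, HasDerivAt G (S.op t x) t := fun t =>
    intervalIntegral.integral_hasDerivAt_right (hc.intervalIntegrable _ _)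
      hc.stronglyMeasurable.stronglyMeasurableAtFilter hc.continuousAt
  have hS : ∀ t h : ℝ, S.op t (G h) = G (t + h) - G t := by
    intro t h
    have e1 : S.op t (G h) = ∫ s in (0 : ℝ)..h, S.op (t + s) x := by
      have := ((S.op t).restrictScalars ℝ).intervalIntegral_comp_comm
        (hc.intervalIntegrable (μ := MeasureTheory.volume) 0 h)
      simp only [ContinuousLinearMap.coe_restrictScalars'] at this
      rw [← this]
      simp [S.op_add]
    rw [e1, intervalIntegral.integral_comp_add_left (fun s => S.op s x) t, add_zero]
    exact (intervalIntegral.integral_interval_sub_left (hc.intervalIntegrable _ _)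
      (hc.intervalIntegrable _ _)).symm
  have hmem : ∀ h : ℝ, G h ∈ S.generator.domain := by
    intro h
    have hg : (G h, S.op h x - x) ∈ S.generatorGraph := by
      rw [mem_generatorGraph]
      have hd : HasDerivAt (fun t => G (t + h) - G t) (S.op h x - x) 0 := by
        have h1 : HasDerivAt (fun t => G (t + h)) (S.op h x) 0 := by
          have := (hG (0 + h)).comp_add_const 0 h
          rwa [zero_add] at this
        have h2 := hG 0
        rw [S.op_zero] at h2
        exact h1.sub h2
      have := hd.tendsto_slope_zero
      refine this.congr fun t => ?_
      simp only [zero_add, hS, hsm]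
      simp [G]
    rw [← generator_graph] at hg
    exact LinearPMap.mem_domain_of_mem_graph hg
  have hlim : Filter.Tendsto (fun t : ℝ => t⁻¹ • G t) (nhdsWithin 0 {0}ᶜ) (nhds x) := by
    have := (hG 0).tendsto_slope_zero
    rw [S.op_zero] at this
    simpa [G] using this
  refine mem_closure_of_tendsto hlim (Filter.Eventually.of_forall fun t => ?_)
  exact S.generator.domain.smul_mem _ (hmem t)

variable [CompleteSpace H]

/-- The Hilbert space `D(A*)`, where `A*` is the adjoint of the generator `A`, with the scalar
product `⟨z₁, z₂⟩ + ⟨A* z₁, A* z₂⟩`. It is realised as the graph of `A*` inside the Hilbert sum of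
two copies of `H`, that is, `z ∈ D(A*)` is represented by the pair `(z, A* z)`. -/
def adjDom (S : C0Group 𝕜 H) : Submodule 𝕜 (WithLp 2 (H × H)) :=
  (S.generator.adjoint.graph).comap (WithLp.linearEquiv 2 𝕜 (H × H)).toLinearMap

/-- The inclusion `D(A*) ⊂ H`. -/
def adjIncl (S : C0Group 𝕜 H) (z : S.adjDom) : H := z.1.fst

/-- The operator `A* : D(A*) → H`. -/
def adjGen (S : C0Group 𝕜 H) (z : S.adjDom) : H := z.1.snd

theorem mem_adjDom_iff (S : C0Group 𝕜 H) (p : WithLp 2 (H × H)) :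
    p ∈ S.adjDom ↔ ∀ a b, (a, b) ∈ S.generatorGraph → inner 𝕜 b p.fst - inner 𝕜 a p.snd = 0 := by
  rw [← generator_graph]
  change WithLp.ofLp p ∈ S.generator.adjoint.graph ↔ _
  rw [LinearPMap.adjoint_graph_eq_graph_adjoint S.dense_generator_domain,
    Submodule.mem_adjoint_iff]
  rfl

/-- The operator `S(t)*` restricted to `D(A*)`. It commutes with `A*`. -/
def adjOp (S : C0Group 𝕜 H) (t : ℝ) (z : S.adjDom) : S.adjDom :=
  ⟨WithLp.toLp 2 ((S.op t).adjoint (S.adjIncl z), (S.op t).adjoint (S.adjGen z)), by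
    rw [mem_adjDom_iff]
    intro a b hab
    have h := (S.mem_adjDom_iff z.1).1 z.2 _ _ (S.op_mem_generatorGraph t hab)
    simpa [adjIncl, adjGen, ContinuousLinearMap.adjoint_inner_right] using h⟩

end C0Group

section ControlSystem

variable {𝕜 H U : Type*} [RCLike 𝕜]
  [NormedAddCommGroup H] [InnerProductSpace 𝕜 H] [CompleteSpace H]
  [NormedAddCommGroup U] [InnerProductSpace 𝕜 U] [CompleteSpace U]

/-- `L(U, D(A*)')`, where `D(A*)'` is the (anti-)dual of `D(A*)` with respect to the pivot
space `H`: the element `h ∈ H` is identified with the functional `z ↦ ⟨h, z⟩`, which is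
`inner 𝕜 z h` in Mathlib's convention. -/
abbrev ControlOp (S : C0Group 𝕜 H) (U : Type*) [NormedAddCommGroup U] [InnerProductSpace 𝕜 U] :=
  U →L[𝕜] (S.adjDom →L⋆[𝕜] 𝕜)

/-- The adjoint `B* ∈ L(D(A*), U)`, characterised by `⟨u, B* z⟩_U = ⟨B u, z⟩`. -/
def ControlOp.star {S : C0Group 𝕜 H} (B : ControlOp S U) (z : S.adjDom) : U :=
  (InnerProductSpace.toDual 𝕜 U).symm (ContinuousLinearMap.flip B z)

theorem ControlOp.inner_star {S : C0Group 𝕜 H} (B : ControlOp S U) (z : S.adjDom) (u : U) :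
    inner 𝕜 (ControlOp.star B z) u = B u z := by
  simp [ControlOp.star]

/-- `B` is an admissible control operator: for all `T > 0` and `u ∈ L²([0, T]; U)`, the function
`φ(t) = ∫₀ᵗ S(t - s) B u(s) ds`, a priori with values in `D(A*)'`, belongs to `C([0, T]; H)`.
Here `S(t)` acts on `D(A*)'` by `⟨S(t) f, z⟩ = ⟨f, S(t)* z⟩`. -/
def IsAdmissible (S : C0Group 𝕜 H) (B : ControlOp S U) : Prop :=
  ∀ T : ℝ, 0 < T → ∀ u : ℝ → U,
    MeasureTheory.MemLp u 2 (MeasureTheory.volume.restrict (Set.Ioc 0 T)) →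
      ∃ φ : ℝ → H, ContinuousOn φ (Set.Icc 0 T) ∧
        ∀ t ∈ Set.Icc 0 T, ∀ z : S.adjDom,
          inner 𝕜 (S.adjIncl z) (φ t) = ∫ s in (0 : ℝ)..t, B (u s) (S.adjOp (t - s) z)

/-- The operator identity `A Q + Q A* - B W B* + Q R Q + 2 λ Q = 0`, tested on `D(A*)`. -/
def OperatorIdentity (S : C0Group 𝕜 H) (B : ControlOp S U) (Q R : H →L[𝕜] H) (W : U →L[𝕜] U)
    (lam : ℝ) : Prop :=
  ∀ x y : S.adjDom,
    inner 𝕜 (Q (S.adjIncl x)) (S.adjGen y) + inner 𝕜 (S.adjGen x) (Q (S.adjIncl y))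
      - inner 𝕜 (W (ControlOp.star B x)) (ControlOp.star B y)
      + inner 𝕜 (R (Q (S.adjIncl x))) (Q (S.adjIncl y))
      + ((2 * lam : ℝ) : 𝕜) * inner 𝕜 (Q (S.adjIncl x)) (S.adjIncl y) = 0

/-- `Q` is symmetric and positive (that is, coercive). -/
def IsSymmCoercive (Q : H →L[𝕜] H) : Prop :=
  IsSelfAdjoint Q ∧ ∃ κ : ℝ, 0 < κ ∧ ∀ x : H, κ * ‖x‖ ^ 2 ≤ RCLike.re (inner 𝕜 (Q x) x)

/-- `f' = h` in the sense of distributions on `(0, T)`. -/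
def DistribDeriv (T : ℝ) (f h : ℝ → 𝕜) : Prop :=
  ∀ θ : ℝ → ℝ, ContDiff ℝ ((⊤ : ℕ∞) : WithTop ℕ∞) θ → HasCompactSupport θ →
    tsupport θ ⊆ Set.Ioo 0 T →
      ∫ t in (0 : ℝ)..T, ((deriv θ t : ℝ) : 𝕜) * f t
        = - ∫ t in (0 : ℝ)..T, ((θ t : ℝ) : 𝕜) * h t

/-- `z ∈ C([0, T]; H)` is a weak solution of `z' = - A* z + g` in `(0, T)`. -/
def IsAdjWeakSol (S : C0Group 𝕜 H) (T : ℝ) (g z : ℝ → H) : Prop :=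
  ContinuousOn z (Set.Icc 0 T) ∧
    ∀ ψ : S.generator.domain,
      DistribDeriv T (fun t => inner 𝕜 (ψ : H) (z t))
        (fun t => - inner 𝕜 (S.generator ψ) (z t) + inner 𝕜 (ψ : H) (g t))

/-- `v = B* z` in `L²((0, T); U)` for the weak solution `z` of `z' = - A* z + g`. Since `B*` is
only defined on `D(A*)`, this is understood by density: the data `(z(0), g)` are the limit in
`H × L¹((0, T); H)` of data `(Zₙ(0), gₙ)` in `D(A*) × C([0, T]; D(A*))`, whose solutions `Zₙ` are in
`C([0, T]; D(A*))`, and `v` is the limit of `B* Zₙ` in `L²((0, T); U)`. -/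
def IsAdjObservation (S : C0Group 𝕜 H) (B : ControlOp S U) (T : ℝ) (g z : ℝ → H) (v : ℝ → U) :
    Prop :=
  MeasureTheory.MemLp v 2 (MeasureTheory.volume.restrict (Set.Ioc 0 T)) ∧
    ∃ (gs Zs : ℕ → ℝ → S.adjDom),
      (∀ n, ContinuousOn (gs n) (Set.Icc 0 T)) ∧
      (∀ n, ContinuousOn (Zs n) (Set.Icc 0 T)) ∧
      (∀ n, IsAdjWeakSol S T (fun t => S.adjIncl (gs n t)) (fun t => S.adjIncl (Zs n t))) ∧
      Filter.Tendsto (fun n => S.adjIncl (Zs n 0)) Filter.atTop (nhds (z 0)) ∧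
      Filter.Tendsto (fun n => MeasureTheory.eLpNorm (fun t => S.adjIncl (gs n t) - g t) 1
        (MeasureTheory.volume.restrict (Set.Ioc 0 T))) Filter.atTop (nhds 0) ∧
      Filter.Tendsto (fun n => MeasureTheory.eLpNorm (fun t => ControlOp.star B (Zs n t) - v t) 2
        (MeasureTheory.volume.restrict (Set.Ioc 0 T))) Filter.atTop (nhds 0)

/-- `(y, yt) ∈ C([0, T]; H)²` is a weak solution on `(0, T)` of
`y' = A y - B W B* yt`, `yt' = - A* yt - 2 λ yt + λ₁ Q⁻¹ (y - Q yt)`,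
`y(0) = y₀`, `yt(0) = yt₀`. The equations hold in the sense of distributions when tested against
`D(A*)` and against `D((-A*)*) = D(A)` respectively. -/
def IsFeedbackWeakSol (S : C0Group 𝕜 H) (B : ControlOp S U) (Q : H ≃L[𝕜] H) (W : U →L[𝕜] U)
    (lam lam₁ T : ℝ) (y₀ yt₀ : H) (y yt : ℝ → H) : Prop :=
  let g : ℝ → H := fun t =>
    -(((2 * lam : ℝ) : 𝕜) • yt t) + (lam₁ : 𝕜) • Q.symm (y t - Q (yt t))
  ContinuousOn y (Set.Icc 0 T) ∧ y 0 = y₀ ∧ yt 0 = yt₀ ∧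
    IsAdjWeakSol S T g yt ∧
    ∃ v : ℝ → U, IsAdjObservation S B T g yt v ∧
      ∀ φ : S.adjDom,
        DistribDeriv T (fun t => inner 𝕜 (S.adjIncl φ) (y t))
          (fun t => inner 𝕜 (S.adjGen φ) (y t) - B (W (v t)) φ)

/-- Weak solution of the same system on `(0, +∞)`. -/
def IsGlobalFeedbackWeakSol (S : C0Group 𝕜 H) (B : ControlOp S U) (Q : H ≃L[𝕜] H)
    (W : U →L[𝕜] U) (lam lam₁ : ℝ) (y₀ yt₀ : H) (y yt : ℝ → H) : Prop :=
  ∀ T : ℝ, 0 < T → IsFeedbackWeakSol S B Q W lam lam₁ T y₀ yt₀ y yt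

end ControlSystem

end

noncomputable section

open Filter Topology MeasureTheory Set

set_option linter.unusedSectionVars false

/-! ### Strongly continuous groups: bounds, reversal, rescaling and means -/

namespace C0Group

variable {𝕜 H : Type*} [RCLike 𝕜] [NormedAddCommGroup H] [InnerProductSpace 𝕜 H]

/-! Put $w=y-Q\tilde y$. Formally $w'=Ay-BWB^*\tilde y+QA^*\tilde y+2\lambda Q\tilde y-\lambda_1w$,
and the operator identity turns the three terms in $\tilde y$ into $-AQ\tilde y$. Hence
$w'=(A-\lambda_1)w$, and the system is triangular in $(w,\tilde y)$: $w(t)=e^{-\lambda_1t}S(t)w(0)$,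
while $\tilde y$ solves $\tilde y'=-(A^*+2\lambda)\tilde y+\lambda_1Q^{-1}w$ and is given by
Duhamel's formula. This is `IsFeedbackWeakSol.representation`. Uniqueness is immediate from it, and
decay (`exists_decay`) follows because the source $w$ decays faster than the free evolution of
$\tilde y$. Existence (`exists_isGlobalFeedbackWeakSol`) reads the formulas backwards.

Two points need care, since $\tilde y(t)$ need not lie in $\mathcal D(A^*)$. First, the cancellation
must be justified: the identity is applied to the regular approximations that define $B^*\tilde y$,
and the result passes to the limit in the sense of distributions (`IsAdjObservation.distribDeriv`).
Weak equations become explicit formulas through `C0Group.duhamel_of_weak`, which rests on the du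
Bois-Reymond lemma `DistribDeriv.eq_const`.

Second, for existence, $B^*\tilde y$ must be shown to exist. Admissibility gives by duality an
observability estimate for $B^*S(-t)^*z$ (`IsAdmissible.exists_observability`), and
`C0Group.integral_norm_sq_mild_le` extends it to inhomogeneous evolutions. The means
$h^{-1}\int_0^hS(s)^*ds$ map $\mathbb H$ into $\mathcal D(A^*)$, commute with the evolution and tend
strongly to the identity. Applying $B^*$ to the regularised solution therefore gives a Cauchy
sequence in $L^2$ (`IsAdmissible.exists_isAdjObservation`). -/

theorem op_add_apply (S : C0Group 𝕜 H) (s t : ℝ) (x : H) :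
    S.op (s + t) x = S.op s (S.op t x) := by
  rw [S.op_add]; rfl

theorem op_zero_apply (S : C0Group 𝕜 H) (x : H) : S.op 0 x = x := by
  rw [S.op_zero]; rfl

theorem op_neg_op (S : C0Group 𝕜 H) (t : ℝ) (x : H) : S.op (-t) (S.op t x) = x := by
  rw [← op_add_apply, neg_add_cancel, op_zero_apply]

theorem op_comm (S : C0Group 𝕜 H) (s t : ℝ) (x : H) :
    S.op s (S.op t x) = S.op t (S.op s x) := by
  rw [← op_add_apply, add_comm, op_add_apply]

/-- The time-reversed group `S(-t)`. -/
def rev (S : C0Group 𝕜 H) : C0Group 𝕜 H where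
  op t := S.op (-t)
  op_zero := by rw [neg_zero, S.op_zero]
  op_add s t := by rw [neg_add, S.op_add]
  tendsto_zero x := by
    have h : Tendsto (fun t : ℝ => -t) (𝓝 0) (𝓝 0) := by
      simpa using (continuous_neg (G := ℝ)).tendsto 0
    exact (S.tendsto_zero x).comp h

theorem rev_op (S : C0Group 𝕜 H) (t : ℝ) : S.rev.op t = S.op (-t) := rfl

/-- The rescaled group `exp(μ t) S(t)`. -/
def scale (S : C0Group 𝕜 H) (μ : ℝ) : C0Group 𝕜 H where
  op t := ((Real.exp (μ * t) : ℝ) : 𝕜) • S.op t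
  op_zero := by simp [S.op_zero]
  op_add s t := by
    rw [mul_add, Real.exp_add, S.op_add]
    ext x
    simp only [RCLike.ofReal_mul, smul_apply, ContinuousLinearMap.comp_apply, map_smul, mul_smul]
    rw [smul_comm]
  tendsto_zero x := by
    have h : Continuous fun t : ℝ => ((Real.exp (μ * t) : ℝ) : 𝕜) :=
      RCLike.continuous_ofReal.comp (by fun_prop)
    simpa using (h.tendsto 0).smul (S.tendsto_zero x)

theorem scale_op_apply (S : C0Group 𝕜 H) (μ t : ℝ) (x : H) :
    (S.scale μ).op t x = ((Real.exp (μ * t) : ℝ) : 𝕜) • S.op t x := rfl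

theorem norm_scale_op_apply (S : C0Group 𝕜 H) (μ t : ℝ) (x : H) :
    ‖(S.scale μ).op t x‖ = Real.exp (μ * t) * ‖S.op t x‖ := by
  rw [scale_op_apply, norm_smul, RCLike.norm_ofReal, abs_of_pos (Real.exp_pos _)]

/-- Orbits are continuous, hence bounded on compact time intervals, and the uniform boundedness
principle makes the bound uniform in the vector. -/
theorem exists_op_bound [CompleteSpace H] (S : C0Group 𝕜 H) (T : ℝ) :
    ∃ M : ℝ, 0 ≤ M ∧ ∀ t : ℝ, |t| ≤ T → ‖S.op t‖ ≤ M := by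
  obtain ⟨C, hC⟩ := banach_steinhaus (g := fun t : Icc (-T) T => S.op t) (by
    intro x
    obtain ⟨C, hC⟩ := (isCompact_Icc (a := -T) (b := T)).exists_bound_of_continuousOn
      (S.continuous_op x).continuousOn
    exact ⟨C, fun t => hC t t.2⟩)
  exact ⟨max C 0, le_max_right _ _, fun t ht => (hC ⟨t, abs_le.1 ht⟩).trans (le_max_left _ _)⟩

/-- Split $S(s)z=S(s)(z-x)+S(s)x$: the local operator bound controls the first term, strong
continuity the second. -/
theorem continuous_op_uncurry [CompleteSpace H] (S : C0Group 𝕜 H) :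
    Continuous fun p : ℝ × H => S.op p.1 p.2 := by
  rw [continuous_iff_continuousAt]
  rintro ⟨t, x⟩
  obtain ⟨M, hM0, hM⟩ := S.exists_op_bound (|t| + 1)
  have h1 : Tendsto (fun p : ℝ × H => M * ‖p.2 - x‖) (𝓝 (t, x)) (𝓝 0) := by
    have : Continuous fun p : ℝ × H => M * ‖p.2 - x‖ := by fun_prop
    simpa using this.tendsto (t, x)
  have h2 : Tendsto (fun p : ℝ × H => S.op p.1 x) (𝓝 (t, x)) (𝓝 (S.op t x)) :=
    ((S.continuous_op x).comp continuous_fst).tendsto (t, x)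
  have h3 : Tendsto (fun p : ℝ × H => S.op p.1 (p.2 - x)) (𝓝 (t, x)) (𝓝 0) := by
    refine squeeze_zero_norm' ?_ h1
    have : ∀ᶠ p : ℝ × H in 𝓝 (t, x), |p.1| < |t| + 1 :=
      (continuous_abs.comp continuous_fst).continuousAt.eventually_lt
        (f := fun p : ℝ × H => |p.1|) continuousAt_const (by simp)
    filter_upwards [this] with p hp
    exact (S.op p.1).le_of_opNorm_le (hM _ hp.le) _
  have := h3.add h2
  simpa [ContinuousAt] using this

theorem continuous_op_comp [CompleteSpace H] (S : C0Group 𝕜 H) {X : Type*} [TopologicalSpace X]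
    {a : X → ℝ} {f : X → H} (ha : Continuous a) (hf : Continuous f) :
    Continuous fun x => S.op (a x) (f x) :=
  S.continuous_op_uncurry.comp (ha.prodMk hf)

theorem mem_generatorGraph_rev (S : C0Group 𝕜 H) {p : H × H} (hp : p ∈ S.generatorGraph) :
    (p.1, -p.2) ∈ S.rev.generatorGraph := by
  rw [mem_generatorGraph] at *
  have h : Tendsto (fun t : ℝ => -t) (𝓝[≠] 0) (𝓝[≠] 0) := by
    refine tendsto_nhdsWithin_of_tendsto_nhds_of_eventually_within _ ?_ ?_
    · simpa using ((continuous_neg (G := ℝ)).tendsto 0).mono_left nhdsWithin_le_nhds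
    · filter_upwards [self_mem_nhdsWithin] with t ht
      simpa using ht
  refine (hp.comp h).neg.congr fun t => ?_
  simp [rev_op, inv_neg]

theorem rev_rev (S : C0Group 𝕜 H) : S.rev.rev = S := by
  cases S
  simp [rev]

theorem scale_scale (S : C0Group 𝕜 H) (μ ν : ℝ) : (S.scale μ).scale ν = S.scale (μ + ν) := by
  cases S
  simp [scale, smul_smul, ← Real.exp_add, ← RCLike.ofReal_mul, add_mul, add_comm]

theorem scale_zero (S : C0Group 𝕜 H) : S.scale 0 = S := by
  cases S
  simp [scale]

section RealStructure

variable [NormedSpace ℝ H] [IsScalarTower ℝ 𝕜 H]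

theorem hasDerivAt_op (S : C0Group 𝕜 H) {p : H × H} (hp : p ∈ S.generatorGraph) (t : ℝ) :
    HasDerivAt (fun s => S.op s p.1) (S.op t p.2) t := by
  rw [hasDerivAt_iff_tendsto_slope_zero]
  have := (((S.op t).continuous.tendsto _).comp ((S.mem_generatorGraph p).1 hp))
  refine this.congr fun s => ?_
  simp [op_add_apply, RCLike.real_smul_eq_coe_smul (K := 𝕜)]

theorem mem_generatorGraph_iff_hasDerivAt (S : C0Group 𝕜 H) (p : H × H) :
    p ∈ S.generatorGraph ↔ HasDerivAt (fun s => S.op s p.1) p.2 0 := by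
  rw [hasDerivAt_iff_tendsto_slope_zero, mem_generatorGraph]
  simp [op_zero_apply, RCLike.real_smul_eq_coe_smul (K := 𝕜)]

theorem mem_generatorGraph_scale (S : C0Group 𝕜 H) (μ : ℝ) {p : H × H}
    (hp : p ∈ S.generatorGraph) :
    (p.1, p.2 + (μ : 𝕜) • p.1) ∈ (S.scale μ).generatorGraph := by
  rw [mem_generatorGraph_iff_hasDerivAt] at *
  have h1 : HasDerivAt (fun t : ℝ => Real.exp (μ * t)) μ 0 := by
    simpa using ((hasDerivAt_id (0 : ℝ)).const_mul μ).exp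
  have := h1.smul hp
  simp only [mul_zero, Real.exp_zero, one_smul, op_zero_apply] at this
  simp only [scale_op_apply, ← RCLike.real_smul_eq_coe_smul (K := 𝕜)]
  exact this

theorem mem_generatorGraph_of_scale (S : C0Group 𝕜 H) (μ : ℝ) {p : H × H}
    (hp : p ∈ (S.scale μ).generatorGraph) :
    (p.1, p.2 - (μ : 𝕜) • p.1) ∈ S.generatorGraph := by
  have := (S.scale μ).mem_generatorGraph_scale (-μ) hp
  rw [scale_scale, add_neg_cancel, scale_zero] at this
  simpa [sub_eq_add_neg] using this

variable [CompleteSpace H]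

theorem intervalIntegrable_op (S : C0Group 𝕜 H) (x : H) (a b : ℝ) :
    IntervalIntegrable (fun s => S.op s x) volume a b :=
  (S.continuous_op x).intervalIntegrable _ _

/-- The mean `h⁻¹ ∫₀ʰ S(s) ds` of the group. -/
def avg (S : C0Group 𝕜 H) (h : ℝ) : H →L[𝕜] H :=
  LinearMap.mkContinuousOfExistsBound
    { toFun := fun x => h⁻¹ • ∫ s in (0 : ℝ)..h, S.op s x
      map_add' := fun x y => by
        simp only [map_add]
        rw [intervalIntegral.integral_add (S.intervalIntegrable_op _ _ _)
          (S.intervalIntegrable_op _ _ _), smul_add]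
      map_smul' := fun c x => by
        simp only [map_smul, RingHom.id_apply]
        rw [intervalIntegral.integral_smul, smul_comm] } (by
    obtain ⟨M, hM0, hM⟩ := S.exists_op_bound |h|
    refine ⟨|h|⁻¹ * (M * |h|), fun x => ?_⟩
    have := intervalIntegral.norm_integral_le_of_norm_le_const (a := 0) (b := h)
      (f := fun s => S.op s x) (C := M * ‖x‖) (by
        intro s hs
        refine (S.op s).le_of_opNorm_le (hM s ?_) x
        rcases le_total 0 h with h0 | h0
        · rw [uIoc_of_le h0] at hs
          rw [abs_of_nonneg hs.1.le, abs_of_nonneg h0]; exact hs.2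
        · rw [uIoc_of_ge h0] at hs
          rw [abs_of_nonpos hs.2, abs_of_nonpos h0]; linarith [hs.1])
    simp only [LinearMap.coe_mk, AddHom.coe_mk, norm_smul, norm_inv, Real.norm_eq_abs]
    rw [sub_zero] at this
    calc _ ≤ |h|⁻¹ * (M * ‖x‖ * |h|) := by gcongr
      _ = _ := by ring)

theorem avg_apply (S : C0Group 𝕜 H) (h : ℝ) (x : H) :
    S.avg h x = h⁻¹ • ∫ s in (0 : ℝ)..h, S.op s x := rfl

theorem hasDerivAt_integral_op (S : C0Group 𝕜 H) (x : H) (t : ℝ) :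
    HasDerivAt (fun t => ∫ s in (0 : ℝ)..t, S.op s x) (S.op t x) t :=
  intervalIntegral.integral_hasDerivAt_right (S.intervalIntegrable_op _ _ _)
    (S.continuous_op x).stronglyMeasurable.stronglyMeasurableAtFilter
    (S.continuous_op x).continuousAt

theorem tendsto_avg (S : C0Group 𝕜 H) (x : H) :
    Tendsto (fun h => S.avg h x) (𝓝[≠] 0) (𝓝 x) := by
  have := (S.hasDerivAt_integral_op x 0).tendsto_slope_zero
  simpa [avg_apply, op_zero_apply] using this

theorem op_avg (S : C0Group 𝕜 H) (t h : ℝ) (x : H) :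
    S.op t (S.avg h x) = S.avg h (S.op t x) := by
  rw [avg_apply, avg_apply, RCLike.real_smul_eq_coe_smul (K := 𝕜), map_smul,
    ← ContinuousLinearMap.intervalIntegral_comp_comm (S.op t) (S.intervalIntegrable_op _ _ _),
    ← RCLike.real_smul_eq_coe_smul (K := 𝕜)]
  simp only [S.op_comm t]

/-- The orbit of a mean is a difference of two values of the primitive of $s\mapsto S(s)x$, hence
differentiable for every $x$. This is the regularisation on which all density arguments below rest.
-/
theorem avg_mem_generatorGraph (S : C0Group 𝕜 H) (h : ℝ) (x : H) :
    (S.avg h x, h⁻¹ • (S.op h x - x)) ∈ S.generatorGraph := by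
  rw [mem_generatorGraph_iff_hasDerivAt]
  have hS : ∀ t, S.op t (S.avg h x)
      = h⁻¹ • ((∫ s in (0 : ℝ)..(t + h), S.op s x) - ∫ s in (0 : ℝ)..t, S.op s x) := by
    intro t
    rw [op_avg, avg_apply]
    simp only [← op_add_apply]
    rw [intervalIntegral.integral_comp_add_right (fun s => S.op s x), zero_add,
      intervalIntegral.integral_interval_sub_left (S.intervalIntegrable_op _ _ _)
      (S.intervalIntegrable_op _ _ _), add_comm]
  simp only [hS]
  have h1 := (S.hasDerivAt_integral_op x (0 + h)).comp_add_const 0 h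
  have h2 := S.hasDerivAt_integral_op x 0
  rw [zero_add] at h1
  rw [op_zero_apply] at h2
  exact (h1.sub h2).const_smul h⁻¹

theorem avg_map_mem_generatorGraph (S : C0Group 𝕜 H) (h : ℝ) {p : H × H}
    (hp : p ∈ S.generatorGraph) : (S.avg h p.1, S.avg h p.2) ∈ S.generatorGraph := by
  rw [mem_generatorGraph] at *
  refine (((S.avg h).continuous.tendsto _).comp hp).congr fun t => ?_
  simp [op_avg]

theorem integral_op_generator (S : C0Group 𝕜 H) {p : H × H} (hp : p ∈ S.generatorGraph) (h : ℝ) :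
    ∫ s in (0 : ℝ)..h, S.op s p.2 = S.op h p.1 - p.1 := by
  rw [intervalIntegral.integral_eq_sub_of_hasDerivAt (fun t _ => S.hasDerivAt_op hp t)
    (S.intervalIntegrable_op _ _ _), op_zero_apply]

theorem exists_avg_bound (S : C0Group 𝕜 H) (T : ℝ) :
    ∃ M : ℝ, 0 ≤ M ∧ ∀ h : ℝ, |h| ≤ T → ‖S.avg h‖ ≤ M := by
  obtain ⟨M, hM0, hM⟩ := S.exists_op_bound T
  refine ⟨M, hM0, fun h hT => ContinuousLinearMap.opNorm_le_bound _ hM0 fun x => ?_⟩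
  have := intervalIntegral.norm_integral_le_of_norm_le_const (a := 0) (b := h)
    (f := fun s => S.op s x) (C := M * ‖x‖) (by
      intro s hs
      refine (S.op s).le_of_opNorm_le (hM s (le_trans ?_ hT)) x
      rcases le_total 0 h with h0 | h0
      · rw [uIoc_of_le h0] at hs
        rw [abs_of_nonneg hs.1.le, abs_of_nonneg h0]; exact hs.2
      · rw [uIoc_of_ge h0] at hs
        rw [abs_of_nonpos hs.2, abs_of_nonpos h0]; linarith [hs.1])
  rw [sub_zero] at this
  rw [avg_apply, norm_smul, norm_inv, Real.norm_eq_abs]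
  rcases eq_or_ne h 0 with rfl | h0
  -- The mean over an interval of length zero is the zero operator, because $0^{-1}=0$.
  · simp; positivity
  · calc |h|⁻¹ * _ ≤ |h|⁻¹ * (M * ‖x‖ * |h|) := by gcongr
      _ = M * ‖x‖ := by have := abs_pos.2 h0; field_simp

theorem tendsto_seq_avg (S : C0Group 𝕜 H) (x : H) :
    Tendsto (fun n : ℕ => S.avg ((n : ℝ) + 1)⁻¹ x) atTop (𝓝 x) := by
  have : Tendsto (fun n : ℕ => ((n : ℝ) + 1)⁻¹) atTop (𝓝[≠] 0) := by
    refine tendsto_nhdsWithin_of_tendsto_nhds_of_eventually_within _ ?_ ?_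
    · simpa using tendsto_one_div_add_atTop_nhds_zero_nat (𝕜 := ℝ)
    · exact Eventually.of_forall fun n => by simp; positivity
  exact (S.tendsto_avg x).comp this

end RealStructure

end C0Group

theorem inner_intervalIntegral {𝕜 H : Type*} [RCLike 𝕜] [NormedAddCommGroup H]
    [InnerProductSpace 𝕜 H] [CompleteSpace H] [NormedSpace ℝ H] {f : ℝ → H} {a b : ℝ}
    (hf : IntervalIntegrable f volume a b) (x : H) :
    inner 𝕜 x (∫ s in a..b, f s) = ∫ s in a..b, inner 𝕜 x (f s) :=
  (ContinuousLinearMap.intervalIntegral_comp_comm (innerSL 𝕜 x) hf).symm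

/-! ### The adjoint group and its generator $A^*$ -/

namespace C0Group

variable {𝕜 H : Type*} [RCLike 𝕜] [NormedAddCommGroup H] [InnerProductSpace 𝕜 H]
  [CompleteSpace H]

theorem inner_generator_adjDom (S : C0Group 𝕜 H) (z : S.adjDom) {a b : H}
    (hab : (a, b) ∈ S.generatorGraph) :
    inner 𝕜 b (S.adjIncl z) = inner 𝕜 a (S.adjGen z) :=
  sub_eq_zero.1 ((S.mem_adjDom_iff z.1).1 z.2 a b hab)

theorem adjDom_ext (S : C0Group 𝕜 H) {z z' : S.adjDom} (h1 : S.adjIncl z = S.adjIncl z')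
    (h2 : S.adjGen z = S.adjGen z') : z = z' := by
  apply Subtype.ext
  apply (WithLp.linearEquiv 2 𝕜 (H × H)).injective
  exact Prod.ext h1 h2

theorem mem_adjDom_of_tendsto (S : C0Group 𝕜 H) {z a : H}
    (h : Tendsto (fun t : ℝ => ((t⁻¹ : ℝ) : 𝕜) • ((S.op t).adjoint z - z)) (𝓝[≠] 0) (𝓝 a)) :
    WithLp.toLp 2 (z, a) ∈ S.adjDom := by
  rw [mem_adjDom_iff]
  intro x y hxy
  rw [sub_eq_zero]
  have h1 : Tendsto (fun t : ℝ => inner 𝕜 (((t⁻¹ : ℝ) : 𝕜) • (S.op t x - x)) z)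
      (𝓝[≠] 0) (𝓝 (inner 𝕜 y z)) := Tendsto.inner hxy tendsto_const_nhds
  have h2 : Tendsto (fun t : ℝ => inner 𝕜 x (((t⁻¹ : ℝ) : 𝕜) • ((S.op t).adjoint z - z)))
      (𝓝[≠] 0) (𝓝 (inner 𝕜 x a)) := Tendsto.inner tendsto_const_nhds h
  refine tendsto_nhds_unique h1 (h2.congr fun t => ?_)
  rw [inner_smul_left, inner_smul_right, RCLike.conj_ofReal, inner_sub_left, inner_sub_right,
    ContinuousLinearMap.adjoint_inner_right]

variable [NormedSpace ℝ H] [IsScalarTower ℝ 𝕜 H]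

/-- Test against $x$ and use that the mean of $x$ over $[0,t]$ lies in $\mathcal D(A)$, with image
$t^{-1}(S(t)x-x)$. Working by duality avoids integrating the adjoint orbit, whose continuity is
deduced from this formula. -/
theorem adjoint_op_sub (S : C0Group 𝕜 H) (z : S.adjDom) (t : ℝ) :
    (S.op t).adjoint (S.adjIncl z) - S.adjIncl z = t • (S.avg t).adjoint (S.adjGen z) := by
  rcases eq_or_ne t 0 with rfl | ht
  · simp [S.op_zero, ContinuousLinearMap.adjoint_id]
  refine ext_inner_left 𝕜 fun x => ?_
  have h := S.inner_generator_adjDom z (S.avg_mem_generatorGraph t x)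
  rw [RCLike.real_smul_eq_coe_smul (K := 𝕜), inner_smul_left, RCLike.conj_ofReal] at h
  rw [inner_sub_right, RCLike.real_smul_eq_coe_smul (K := 𝕜), inner_smul_right,
    ContinuousLinearMap.adjoint_inner_right, ContinuousLinearMap.adjoint_inner_right, ← h,
    ← mul_assoc, ← RCLike.ofReal_mul, mul_inv_cancel₀ ht, inner_sub_left]
  simp

theorem avg_adjoint_mem_adjDom (S : C0Group 𝕜 H) (h : ℝ) (z : H) :
    WithLp.toLp 2 ((S.avg h).adjoint z, h⁻¹ • ((S.op h).adjoint z - z)) ∈ S.adjDom := by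
  rw [mem_adjDom_iff]
  intro a b hab
  have h1 : S.avg h b = h⁻¹ • (S.op h a - a) := by
    rw [avg_apply, S.integral_op_generator hab]
  simp only [WithLp.toLp_fst, WithLp.toLp_snd]
  rw [ContinuousLinearMap.adjoint_inner_right, h1, RCLike.real_smul_eq_coe_smul (K := 𝕜),
    RCLike.real_smul_eq_coe_smul (K := 𝕜), inner_smul_left, inner_smul_right,
    RCLike.conj_ofReal, inner_sub_left, inner_sub_right, ContinuousLinearMap.adjoint_inner_right,
    sub_self]

/-- Adjoints of means take values in $\mathcal D(A^*)$, so a vector orthogonal to $\mathcal D(A^*)$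
has vanishing means. These tend to the vector itself. -/
theorem dense_range_adjIncl (S : C0Group 𝕜 H) : DenseRange S.adjIncl := by
  let K : Submodule 𝕜 H := S.adjDom.map (WithLp.fstₗ 2 𝕜 H H)
  have hK : (K : Set H) = range S.adjIncl := by
    ext x
    constructor
    · rintro ⟨p, hp, rfl⟩
      exact ⟨⟨p, hp⟩, rfl⟩
    · rintro ⟨p, rfl⟩
      exact ⟨p.1, p.2, rfl⟩
  have h0 : Kᗮ = ⊥ := by
    rw [Submodule.eq_bot_iff]
    intro x hx
    have h1 : ∀ h : ℝ, S.avg h x = 0 := by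
      intro h
      refine ext_inner_right 𝕜 fun z => ?_
      have := (Submodule.mem_orthogonal' K x).1 hx _ ⟨_, S.avg_adjoint_mem_adjDom h z, rfl⟩
      rw [inner_zero_left, ← this]
      exact (ContinuousLinearMap.adjoint_inner_right _ _ _).symm
    have h2 := S.tendsto_avg x
    simp only [h1] at h2
    exact tendsto_nhds_unique h2 tendsto_const_nhds |>.trans rfl
  have := Submodule.topologicalClosure_eq_top_iff.2 h0
  rw [← Submodule.dense_iff_topologicalClosure_eq_top, hK] at this
  exact this

/-- On $\mathcal D(A^*)$ the convergence has rate $|t|$ by `adjoint_op_sub`; density and the local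
bound on $\|S(t)^*\|$ extend it to $\mathbb H$. -/
theorem tendsto_adjoint_op (S : C0Group 𝕜 H) (x : H) :
    Tendsto (fun t => (S.op t).adjoint x) (𝓝 0) (𝓝 x) := by
  obtain ⟨M, hM0, hM⟩ := S.exists_op_bound 1
  obtain ⟨N, hN0, hN⟩ := S.exists_avg_bound 1
  have hev : ∀ᶠ t : ℝ in 𝓝 0, |t| ≤ 1 := by
    have : Tendsto (fun t : ℝ => |t|) (𝓝 0) (𝓝 0) := by
      simpa using (continuous_abs (G := ℝ)).tendsto 0
    filter_upwards [this.eventually_lt_const one_pos] with t ht using ht.le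
  rw [tendsto_iff_norm_sub_tendsto_zero, Metric.tendsto_nhds]
  intro ε hε
  -- This tolerance makes the total approximation error $(M+1)\|x-z\|$ smaller than $\varepsilon/2$.
  obtain ⟨z, hz⟩ := S.dense_range_adjIncl.exists_dist_lt x
    (ε := ε / (2 * (M + 1))) (by positivity)
  have h1 : Tendsto (fun t : ℝ => |t| * (N * ‖S.adjGen z‖)) (𝓝 0) (𝓝 0) := by
    have : Continuous fun t : ℝ => |t| * (N * ‖S.adjGen z‖) := by fun_prop
    simpa using this.tendsto 0
  filter_upwards [hev, h1.eventually_lt_const (half_pos hε)] with t ht h2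
  rw [dist_zero_right, norm_norm]
  have e : (S.op t).adjoint x - x = (S.op t).adjoint (x - S.adjIncl z)
      + t • (S.avg t).adjoint (S.adjGen z) - (x - S.adjIncl z) := by
    rw [← adjoint_op_sub, map_sub]; abel
  have b1 : ‖(S.op t).adjoint (x - S.adjIncl z)‖ ≤ M * ‖x - S.adjIncl z‖ := by
    refine ContinuousLinearMap.le_of_opNorm_le _ ?_ _
    rw [LinearIsometryEquiv.norm_map]; exact hM t ht
  have b2 : ‖t • (S.avg t).adjoint (S.adjGen z)‖ ≤ |t| * (N * ‖S.adjGen z‖) := by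
    rw [norm_smul, Real.norm_eq_abs]
    refine mul_le_mul_of_nonneg_left (ContinuousLinearMap.le_of_opNorm_le _ ?_ _) (abs_nonneg t)
    rw [LinearIsometryEquiv.norm_map]; exact hN t ht
  rw [dist_eq_norm, lt_div_iff₀ (by positivity)] at hz
  calc ‖(S.op t).adjoint x - x‖ ≤ M * ‖x - S.adjIncl z‖ + |t| * (N * ‖S.adjGen z‖)
        + ‖x - S.adjIncl z‖ := by
        rw [e]; exact (norm_sub_le _ _).trans (by gcongr; exact (norm_add_le _ _).trans (by gcongr))
    _ < ε := by linarith

/-- The adjoint group `S(t)*`. -/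
def adj (S : C0Group 𝕜 H) : C0Group 𝕜 H where
  op t := (S.op t).adjoint
  op_zero := by rw [S.op_zero, ContinuousLinearMap.adjoint_id]
  op_add s t := by rw [add_comm, S.op_add, ContinuousLinearMap.adjoint_comp]
  tendsto_zero := S.tendsto_adjoint_op

theorem adj_op (S : C0Group 𝕜 H) (t : ℝ) : S.adj.op t = (S.op t).adjoint := rfl

theorem adj_avg (S : C0Group 𝕜 H) (h : ℝ) : S.adj.avg h = (S.avg h).adjoint := by
  ext x
  refine ext_inner_right 𝕜 fun y => ?_
  rw [ContinuousLinearMap.adjoint_inner_left, ← inner_conj_symm, avg_apply, avg_apply,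
    RCLike.real_smul_eq_coe_smul (K := 𝕜), RCLike.real_smul_eq_coe_smul (K := 𝕜),
    inner_smul_right, inner_smul_right, inner_intervalIntegral (S.intervalIntegrable_op _ _ _),
    inner_intervalIntegral (S.adj.intervalIntegrable_op _ _ _), map_mul, RCLike.conj_ofReal,
    intervalIntegral.intervalIntegral_eq_integral_uIoc,
    intervalIntegral.intervalIntegral_eq_integral_uIoc, RCLike.real_smul_eq_coe_smul (K := 𝕜),
    RCLike.real_smul_eq_coe_smul (K := 𝕜), smul_eq_mul, smul_eq_mul, map_mul, RCLike.conj_ofReal,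
    ← integral_conj]
  congr 3
  ext s
  rw [inner_conj_symm, adj_op, ContinuousLinearMap.adjoint_inner_left]

/-- The generator of $S(t)^*$ is exactly $A^*$: for $z\in\mathcal D(A^*)$ the difference quotient at
$z$ is the mean of $A^*z$ under the adjoint group, which converges. The group results above thus
apply to $A^*$. -/
theorem mem_adjDom_iff_mem_generatorGraph (S : C0Group 𝕜 H) (z a : H) :
    WithLp.toLp 2 (z, a) ∈ S.adjDom ↔ (z, a) ∈ S.adj.generatorGraph := by
  constructor
  · intro h
    rw [mem_generatorGraph]
    refine (S.adj.tendsto_avg a).congr' ?_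
    filter_upwards [self_mem_nhdsWithin] with t ht
    have := S.adjoint_op_sub ⟨_, h⟩ t
    change (S.op t).adjoint z - z = t • (S.avg t).adjoint a at this
    rw [← adj_avg] at this
    simp only [adj_op]
    rw [this, ← RCLike.real_smul_eq_coe_smul (K := 𝕜), smul_smul, inv_mul_cancel₀ ht, one_smul]
  · exact S.mem_adjDom_of_tendsto

theorem adjDom_mem_generatorGraph (S : C0Group 𝕜 H) (z : S.adjDom) :
    (S.adjIncl z, S.adjGen z) ∈ S.adj.generatorGraph :=
  (S.mem_adjDom_iff_mem_generatorGraph _ _).1 z.2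

theorem adjIncl_adjOp (S : C0Group 𝕜 H) (t : ℝ) (z : S.adjDom) :
    S.adjIncl (S.adjOp t z) = S.adj.op t (S.adjIncl z) := rfl

theorem adjGen_adjOp (S : C0Group 𝕜 H) (t : ℝ) (z : S.adjDom) :
    S.adjGen (S.adjOp t z) = S.adj.op t (S.adjGen z) := rfl

theorem adjOp_adjOp (S : C0Group 𝕜 H) (s t : ℝ) (z : S.adjDom) :
    S.adjOp s (S.adjOp t z) = S.adjOp (s + t) z := by
  apply adjDom_ext
  · simp only [adjIncl_adjOp, op_add_apply]
  · simp only [adjGen_adjOp, op_add_apply]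

theorem continuous_adjOp (S : C0Group 𝕜 H) {X : Type*} [TopologicalSpace X] {a : X → ℝ}
    (ha : Continuous a) (z : S.adjDom) : Continuous fun x => S.adjOp (a x) z := by
  refine Continuous.subtype_mk ?_ _
  exact (WithLp.prod_continuous_toLp 2 H H).comp
    (((S.adj.continuous_op _).comp ha).prodMk ((S.adj.continuous_op _).comp ha))

/-- The mean of the adjoint group, as an operator from `H` into `D(A*)`. -/
def adjAvg (S : C0Group 𝕜 H) (h : ℝ) : H →L[𝕜] S.adjDom :=
  (((WithLp.prodContinuousLinearEquiv 2 𝕜 H H).symm : H × H →L[𝕜] WithLp 2 (H × H)).comp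
    ((S.adj.avg h).prod
      (((h⁻¹ : ℝ) : 𝕜) • (S.adj.op h - ContinuousLinearMap.id 𝕜 H)))).codRestrict S.adjDom (by
    intro x
    refine (S.mem_adjDom_iff_mem_generatorGraph _ _).2 ?_
    have := S.adj.avg_mem_generatorGraph h x
    rw [RCLike.real_smul_eq_coe_smul (K := 𝕜)] at this
    exact this)

theorem adjIncl_adjAvg (S : C0Group 𝕜 H) (h : ℝ) (x : H) :
    S.adjIncl (S.adjAvg h x) = S.adj.avg h x := rfl

theorem adjGen_adjAvg (S : C0Group 𝕜 H) (h : ℝ) (x : H) :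
    S.adjGen (S.adjAvg h x) = ((h⁻¹ : ℝ) : 𝕜) • (S.adj.op h x - x) := rfl

theorem adjOp_adjAvg (S : C0Group 𝕜 H) (t h : ℝ) (x : H) :
    S.adjOp t (S.adjAvg h x) = S.adjAvg h (S.adj.op t x) := by
  apply adjDom_ext
  · simp only [adjIncl_adjOp, adjIncl_adjAvg, op_avg]
  · simp only [adjGen_adjOp, adjGen_adjAvg, map_smul, map_sub, S.adj.op_comm t]

end C0Group

/-! ### Distributional derivatives on $(0,T)$ -/

section Distributions

variable {𝕜 : Type*} [RCLike 𝕜] {T : ℝ} {f f' h h' : ℝ → 𝕜}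

theorem intervalIntegrable_testFunction_mul {θ : ℝ → ℝ} (hθ : Continuous θ)
    (hf : IntervalIntegrable f volume 0 T) :
    IntervalIntegrable (fun t => ((θ t : ℝ) : 𝕜) * f t) volume 0 T :=
  hf.continuousOn_mul (RCLike.continuous_ofReal.comp hθ).continuousOn

theorem DistribDeriv.sub (hf : IntervalIntegrable f volume 0 T)
    (hf' : IntervalIntegrable f' volume 0 T) (hh : IntervalIntegrable h volume 0 T)
    (hh' : IntervalIntegrable h' volume 0 T) (H : DistribDeriv T f h) (H' : DistribDeriv T f' h') :
    DistribDeriv T (fun t => f t - f' t) (fun t => h t - h' t) := by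
  intro θ hθ hc hs
  have c1 := hθ.continuous
  have c2 := hθ.continuous_deriv (by simp)
  simp only [mul_sub]
  rw [intervalIntegral.integral_sub (intervalIntegrable_testFunction_mul c2 hf)
    (intervalIntegrable_testFunction_mul c2 hf'),
    intervalIntegral.integral_sub (intervalIntegrable_testFunction_mul c1 hh)
    (intervalIntegrable_testFunction_mul c1 hh'), H θ hθ hc hs, H' θ hθ hc hs]
  ring

theorem DistribDeriv.add (hf : IntervalIntegrable f volume 0 T)
    (hf' : IntervalIntegrable f' volume 0 T) (hh : IntervalIntegrable h volume 0 T)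
    (hh' : IntervalIntegrable h' volume 0 T) (H : DistribDeriv T f h) (H' : DistribDeriv T f' h') :
    DistribDeriv T (fun t => f t + f' t) (fun t => h t + h' t) := by
  intro θ hθ hc hs
  have c1 := hθ.continuous
  have c2 := hθ.continuous_deriv (by simp)
  simp only [mul_add]
  rw [intervalIntegral.integral_add (intervalIntegrable_testFunction_mul c2 hf)
    (intervalIntegrable_testFunction_mul c2 hf'),
    intervalIntegral.integral_add (intervalIntegrable_testFunction_mul c1 hh)
    (intervalIntegrable_testFunction_mul c1 hh'), H θ hθ hc hs, H' θ hθ hc hs]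
  ring

/-- Integration by parts; the boundary terms vanish since test functions are supported in the open
interval. -/
theorem DistribDeriv.of_hasDerivAt (hT : 0 ≤ T) (hf : ContinuousOn f (Icc 0 T))
    (hd : ∀ t ∈ Ioo 0 T, HasDerivAt f (h t) t) (hh : IntervalIntegrable h volume 0 T) :
    DistribDeriv T f h := by
  intro θ hθ hc hs
  have c1 := hθ.continuous
  have c2 := hθ.continuous_deriv (by simp)
  have hz : ∀ t, t ∉ Ioo 0 T → θ t = 0 := fun t ht =>
    image_eq_zero_of_notMem_tsupport fun h => ht (hs h)
  have key := intervalIntegral.integral_eq_sub_of_hasDerivAt_of_le hT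
    (f := fun t => ((θ t : ℝ) : 𝕜) * f t)
    (f' := fun t => ((deriv θ t : ℝ) : 𝕜) * f t + ((θ t : ℝ) : 𝕜) * h t)
    ((RCLike.continuous_ofReal.comp c1).continuousOn.mul hf) (fun t ht =>
      ((RCLike.ofRealCLM (K := 𝕜)).hasFDerivAt.comp_hasDerivAt t
        ((hθ.differentiable (by simp)) t).hasDerivAt).mul (hd t ht))
    ((intervalIntegrable_testFunction_mul c2 (hf.intervalIntegrable_of_Icc hT)).add
      (intervalIntegrable_testFunction_mul c1 hh))
  rw [intervalIntegral.integral_add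
    (intervalIntegrable_testFunction_mul c2 (hf.intervalIntegrable_of_Icc hT))
    (intervalIntegrable_testFunction_mul c1 hh)] at key
  simp only [hz 0 (by simp), hz T (by simp), RCLike.ofReal_zero, zero_mul, sub_zero] at key
  exact eq_neg_of_add_eq_zero_left key

theorem DistribDeriv.congr (hT : 0 ≤ T) (H : DistribDeriv T f h)
    (h1 : ∀ t ∈ Ioc 0 T, f t = f' t) (h2 : ∀ t ∈ Ioc 0 T, h t = h' t) : DistribDeriv T f' h' := by
  intro θ hθ hc hs
  have := H θ hθ hc hs
  rw [intervalIntegral.integral_of_le hT, intervalIntegral.integral_of_le hT] at *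
  rw [setIntegral_congr_fun (g := fun t => ((deriv θ t : ℝ) : 𝕜) * f t) measurableSet_Ioc
      (fun t ht => by simp only [h1 t ht]), this,
    setIntegral_congr_fun (g := fun t => ((θ t : ℝ) : 𝕜) * h' t) measurableSet_Ioc
      (fun t ht => by simp only [h2 t ht])]

theorem tendsto_integral_testFunction_mul (hT : 0 ≤ T) {θ : ℝ → ℝ} (hθ : Continuous θ)
    {F : ℕ → ℝ → 𝕜} (hF : ∀ n, IntervalIntegrable (F n) volume 0 T)
    (hf : IntervalIntegrable f volume 0 T)
    (hlim : Tendsto (fun n => eLpNorm (fun t => F n t - f t) 1 (volume.restrict (Ioc 0 T)))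
      atTop (𝓝 0)) :
    Tendsto (fun n => ∫ t in (0 : ℝ)..T, ((θ t : ℝ) : 𝕜) * F n t) atTop
      (𝓝 (∫ t in (0 : ℝ)..T, ((θ t : ℝ) : 𝕜) * f t)) := by
  obtain ⟨C, hC⟩ := (isCompact_Icc (a := (0 : ℝ)) (b := T)).exists_bound_of_continuousOn
    hθ.continuousOn
  simp only [intervalIntegral.integral_of_le hT]
  have i1 := fun n => (intervalIntegrable_iff_integrableOn_Ioc_of_le hT).1
    (intervalIntegrable_testFunction_mul hθ (hF n))
  have i2 := (intervalIntegrable_iff_integrableOn_Ioc_of_le hT).1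
    (intervalIntegrable_testFunction_mul hθ hf)
  refine tendsto_integral_of_L1' _ i2.1 (Eventually.of_forall i1) ?_
  have h0 : Tendsto (fun n => ENNReal.ofReal C *
      eLpNorm (fun t => F n t - f t) 1 (volume.restrict (Ioc 0 T))) atTop (𝓝 0) := by
    simpa using ENNReal.Tendsto.const_mul hlim (Or.inr ENNReal.ofReal_ne_top)
  refine tendsto_of_tendsto_of_tendsto_of_le_of_le tendsto_const_nhds h0
    (fun _ => zero_le) fun n => ?_
  refine eLpNorm_le_mul_eLpNorm_of_ae_le_mul ?_ 1
  filter_upwards [ae_restrict_mem measurableSet_Ioc] with t ht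
  rw [Pi.sub_apply, ← mul_sub, norm_mul, RCLike.norm_ofReal]
  exact mul_le_mul_of_nonneg_right (hC t (Ioc_subset_Icc_self ht)) (norm_nonneg _)

/-- Each side of the defining equation pairs with a fixed bounded function, so both are continuous
for $L^1$ convergence. -/
theorem DistribDeriv.of_tendsto (hT : 0 ≤ T) {F G : ℕ → ℝ → 𝕜}
    (hF : ∀ n, IntervalIntegrable (F n) volume 0 T) (hf : IntervalIntegrable f volume 0 T)
    (hG : ∀ n, IntervalIntegrable (G n) volume 0 T) (hh : IntervalIntegrable h volume 0 T)
    (hFl : Tendsto (fun n => eLpNorm (fun t => F n t - f t) 1 (volume.restrict (Ioc 0 T)))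
      atTop (𝓝 0))
    (hGl : Tendsto (fun n => eLpNorm (fun t => G n t - h t) 1 (volume.restrict (Ioc 0 T)))
      atTop (𝓝 0))
    (H : ∀ n, DistribDeriv T (F n) (G n)) : DistribDeriv T f h := by
  intro θ hθ hc hs
  refine tendsto_nhds_unique
    (tendsto_integral_testFunction_mul hT (hθ.continuous_deriv (by simp)) hF hf hFl) ?_
  refine (tendsto_integral_testFunction_mul hT hθ.continuous hG hh hGl).neg.congr fun n => ?_
  rw [H n θ hθ hc hs]

/-- A smooth function compactly supported in an interval, with zero integral, is the derivative of
a smooth function compactly supported in the same interval. -/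
theorem exists_testFunction_primitive {η : ℝ → ℝ}
    (hη : ContDiff ℝ ((⊤ : ℕ∞) : WithTop ℕ∞) η) (hc : HasCompactSupport η)
    (hs : tsupport η ⊆ Ioo 0 T) (h0 : ∫ t, η t = 0) :
    ∃ θ : ℝ → ℝ, ContDiff ℝ ((⊤ : ℕ∞) : WithTop ℕ∞) θ ∧ HasCompactSupport θ ∧
      tsupport θ ⊆ Ioo 0 T ∧ deriv θ = η := by
  rcases (tsupport η).eq_empty_or_nonempty with he | hne
  · have : η = 0 := by simpa [tsupport, closure_empty_iff] using he
    subst this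
    exact ⟨0, contDiff_const, HasCompactSupport.zero, by simp [tsupport], by ext; simp⟩
  -- The extreme points of the support lie in $(0,T)$. The primitive from $a$ vanishes before $a$
  -- trivially and after $b$ because the total integral is zero.
  obtain ⟨a, ha, hal⟩ := (show IsCompact (tsupport η) from hc).exists_isLeast hne
  obtain ⟨b, hb, hbu⟩ := (show IsCompact (tsupport η) from hc).exists_isGreatest hne
  have hz : ∀ t, t ∉ Icc a b → η t = 0 := fun t ht =>
    image_eq_zero_of_notMem_tsupport fun h => ht ⟨hal h, hbu h⟩
  have hcη := hη.continuous
  let θ : ℝ → ℝ := fun t => ∫ s in a..t, η s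
  have hd : ∀ t, HasDerivAt θ (η t) t := fun t =>
    intervalIntegral.integral_hasDerivAt_right (hcη.intervalIntegrable _ _)
      hcη.stronglyMeasurable.stronglyMeasurableAtFilter hcη.continuousAt
  have hd' : deriv θ = η := funext fun t => (hd t).deriv
  have hθ0 : ∀ t, t ∉ Icc a b → θ t = 0 := by
    intro t ht
    rcases lt_or_ge t a with h1 | h1
    · change ∫ s in a..t, η s = 0
      rw [intervalIntegral.integral_symm, intervalIntegral.integral_of_le h1.le,
        integral_Ioc_eq_integral_Ioo, setIntegral_eq_zero_of_forall_eq_zero, neg_zero]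
      intro s hs
      exact hz s fun h => absurd h.1 (not_le.2 hs.2)
    · have h2 : b < t := not_le.1 fun h => ht ⟨h1, h⟩
      change ∫ s in a..t, η s = 0
      rw [intervalIntegral.integral_of_le h1, ← integral_Icc_eq_integral_Ioc,
        setIntegral_eq_integral_of_forall_compl_eq_zero, h0]
      intro s hs
      exact hz s fun h => hs ⟨h.1, h.2.trans h2.le⟩
  have hts : tsupport θ ⊆ Icc a b := by
    refine closure_minimal (fun t ht => ?_) isClosed_Icc
    by_contra hn
    exact ht (hθ0 t hn)
  refine ⟨θ, ?_, HasCompactSupport.intro isCompact_Icc hθ0, ?_, hd'⟩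
  · rw [contDiff_infty_iff_deriv, hd']
    exact ⟨fun t => (hd t).differentiableAt, hη⟩
  · exact hts.trans fun t ht => ⟨(hs ha).1.trans_le ht.1, ht.2.trans_lt (hs hb).2⟩

/-- Du Bois-Reymond argument. Subtracting from a test function $\eta$ the multiple $(\int\eta)\,r$
of a fixed bump $r$ of mass one leaves the derivative of a test function, so $\int\eta(f-c)=0$ with
$c=\int rf$. Thus $f=c$ almost everywhere, and everywhere by continuity. -/
theorem DistribDeriv.eq_const (hT : 0 < T) (hf : ContinuousOn f (Icc 0 T))
    (H : DistribDeriv T f fun _ => 0) : ∀ t ∈ Icc 0 T, f t = f 0 := by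
  -- Centre $T/2$ and outer radius $T/4$ keep the support inside $(0,T)$.
  let ρ : ContDiffBump (T / 2) := ⟨T / 8, T / 4, by positivity, by linarith⟩
  let r : ℝ → ℝ := ρ.normed volume
  have hr : ContDiff ℝ ((⊤ : ℕ∞) : WithTop ℕ∞) r := ρ.contDiff_normed
  have hrc : HasCompactSupport r := ρ.hasCompactSupport_normed
  have hrs : tsupport r ⊆ Ioo 0 T := by
    change tsupport (ρ.normed volume) ⊆ _
    rw [ρ.tsupport_normed_eq, Real.closedBall_eq_Icc]
    intro t ht
    have h1 : T / 2 - T / 4 ≤ t := ht.1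
    have h2 : t ≤ T / 2 + T / 4 := ht.2
    exact ⟨by linarith, by linarith⟩
  have hr1 : ∫ t, r t = 1 := ρ.integral_normed
  have hfi := hf.intervalIntegrable_of_Icc (μ := volume) hT.le
  let c : 𝕜 := ∫ t in (0 : ℝ)..T, ((r t : ℝ) : 𝕜) * f t
  have hvol : ∀ g : ℝ → ℝ, tsupport g ⊆ Ioo 0 T → ∀ u : ℝ → 𝕜,
      ∫ t, g t • u t = ∫ t in (0 : ℝ)..T, ((g t : ℝ) : 𝕜) * u t := by
    intro g hg u
    rw [intervalIntegral.integral_of_le hT.le, ← setIntegral_eq_integral_of_forall_compl_eq_zero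
      (s := Ioc 0 T)]
    · simp only [RCLike.real_smul_eq_coe_mul]
    · intro t ht
      rw [image_eq_zero_of_notMem_tsupport (f := g) fun h => ht (Ioo_subset_Ioc_self (hg h)),
        zero_smul]
  have hae : ∀ᵐ t : ℝ, t ∈ Ioo 0 T → f t - c = 0 := by
    refine isOpen_Ioo.ae_eq_zero_of_integral_contDiff_smul_eq_zero
      (f := fun t => f t - c) ?_ fun η hη hηc hηs => ?_
    · exact ((hf.mono Ioo_subset_Icc_self).sub continuousOn_const).locallyIntegrableOn
        measurableSet_Ioo
    · let m : ℝ := ∫ t, η t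
      have hηi : Integrable η := hη.continuous.integrable_of_hasCompactSupport hηc
      have hri : Integrable r := hr.continuous.integrable_of_hasCompactSupport hrc
      have ht : tsupport (fun t => η t - m * r t) ⊆ tsupport η ∪ tsupport r := by
        refine closure_minimal (fun t ht => ?_)
          ((isClosed_tsupport _).union (isClosed_tsupport _))
        by_contra hn
        simp only [mem_union, not_or] at hn
        apply ht
        simp [image_eq_zero_of_notMem_tsupport hn.1, image_eq_zero_of_notMem_tsupport hn.2]
      obtain ⟨θ, h1, h2, h3, h4⟩ := exists_testFunction_primitive (T := T)
        (η := fun t => η t - m * r t) (hη.sub (contDiff_const.mul hr))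
        (hηc.sub (hrc.mul_left (f := fun _ => m))) (ht.trans (union_subset hηs hrs)) (by
          rw [integral_sub hηi (hri.const_mul m), integral_const_mul, hr1]
          simp [m])
      have h5 := H θ h1 h2 h3
      rw [h4] at h5
      simp only [mul_zero, intervalIntegral.integral_zero, neg_zero] at h5
      have e : ∀ t, ((η t - m * r t : ℝ) : 𝕜) * f t
          = ((η t : ℝ) : 𝕜) * f t - (m : 𝕜) * (((r t : ℝ) : 𝕜) * f t) := by
        intro t; push_cast; ring
      simp only [e] at h5
      rw [intervalIntegral.integral_sub
        (intervalIntegrable_testFunction_mul hη.continuous hfi)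
        ((intervalIntegrable_testFunction_mul hr.continuous hfi).const_mul _),
        intervalIntegral.integral_const_mul] at h5
      rw [hvol η hηs]
      simp only [mul_sub]
      rw [intervalIntegral.integral_sub
        (intervalIntegrable_testFunction_mul hη.continuous hfi)
        (intervalIntegrable_testFunction_mul hη.continuous
          (_root_.intervalIntegrable_const)), ← h5]
      have e2 : ∫ t in (0 : ℝ)..T, ((η t : ℝ) : 𝕜) * c = (m : 𝕜) * c := by
        rw [← hvol η hηs, integral_smul_const, RCLike.real_smul_eq_coe_mul]
      rw [e2]
  have heq : EqOn f (fun _ => c) (Icc 0 T) := by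
    refine Measure.eqOn_Icc_of_ae_eq volume hT.ne ?_ hf continuousOn_const
    rw [← Measure.restrict_congr_set Ioo_ae_eq_Icc]
    rw [EventuallyEq, ae_restrict_iff' measurableSet_Ioo]
    filter_upwards [hae] with t h1 h2 using sub_eq_zero.1 (h1 h2)
  intro t ht
  rw [heq ht, heq ⟨le_rfl, hT.le⟩]

/-- The primitive of $h$ has the same distributional derivative as $f$, so the difference is
constant. -/
theorem DistribDeriv.eq_add_integral (hT : 0 < T) (hf : ContinuousOn f (Icc 0 T))
    (hh : ContinuousOn h (Icc 0 T)) (H : DistribDeriv T f h) :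
    ∀ t ∈ Icc 0 T, f t = f 0 + ∫ s in (0 : ℝ)..t, h s := by
  have hhi := hh.intervalIntegrable_of_Icc (μ := volume) hT.le
  have hI : ContinuousOn (fun t => ∫ s in (0 : ℝ)..t, h s) (Icc 0 T) := by
    have := intervalIntegral.continuousOn_primitive_interval (μ := volume) (f := h) (a := 0)
      (b := T) (by rw [uIcc_of_le hT.le]; exact hh.integrableOn_Icc)
    rwa [uIcc_of_le hT.le] at this
  have hD : DistribDeriv T (fun t => ∫ s in (0 : ℝ)..t, h s) h := by
    refine DistribDeriv.of_hasDerivAt hT.le hI (fun t ht => ?_) hhi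
    have hn : Icc 0 T ∈ 𝓝 t := Icc_mem_nhds ht.1 ht.2
    refine intervalIntegral.integral_hasDerivAt_right
      ((hh.mono (Icc_subset_Icc_right ht.2.le)).intervalIntegrable_of_Icc ht.1.le) ?_
      (hh.continuousAt hn)
    exact (hh.mono Ioo_subset_Icc_self).stronglyMeasurableAtFilter isOpen_Ioo t ht
  have := DistribDeriv.eq_const (f := fun t => f t - ∫ s in (0 : ℝ)..t, h s) hT (hf.sub hI) (by
    have := H.sub (hf.intervalIntegrable_of_Icc hT.le) (hI.intervalIntegrable_of_Icc hT.le)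
      hhi hhi hD
    simpa only [sub_self] using this)
  intro t ht
  have h1 := this t ht
  simp only [intervalIntegral.integral_same, sub_zero] at h1
  rw [← h1]; ring

end Distributions

/-! ### Duhamel's formula for weak solutions -/

section MildFormula

variable {𝕜 H : Type*} [RCLike 𝕜] [NormedAddCommGroup H] [InnerProductSpace 𝕜 H]
  [NormedSpace ℝ H] [IsScalarTower ℝ 𝕜 H]

/-- A product rule for $z$ differentiable only against the single vector $p(s)$: the remaining term
$\langle p(r)-p(s),z(r)\rangle$ needs only the continuity of $z$ at $s$. -/
theorem hasDerivAt_inner_of_weak {p z : ℝ → H} {p' : H} {d : 𝕜} {s : ℝ}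
    (hp : HasDerivAt p p' s) (hz : ContinuousAt z s)
    (hd : HasDerivAt (fun r => inner 𝕜 (p s) (z r)) d s) :
    HasDerivAt (fun r => inner 𝕜 (p r) (z r)) (inner 𝕜 p' (z s) + d) s := by
  have h1 : HasDerivAt (fun r => inner 𝕜 (p r - p s) (z r)) (inner 𝕜 p' (z s)) s := by
    rw [hasDerivAt_iff_tendsto_slope_zero] at *
    have h2 : Tendsto (fun r => z (s + r)) (𝓝[≠] 0) (𝓝 (z s)) := by
      have : Tendsto (fun r : ℝ => s + r) (𝓝[≠] 0) (𝓝 s) := by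
        have := (continuous_const_add s).tendsto (0 : ℝ)
        rw [add_zero] at this
        exact this.mono_left nhdsWithin_le_nhds
      exact hz.tendsto.comp this
    refine (hp.inner (𝕜 := 𝕜) h2).congr fun r => ?_
    rw [RCLike.real_smul_eq_coe_smul (K := 𝕜), inner_smul_left, RCLike.conj_ofReal, sub_self,
      inner_zero_left, sub_zero, RCLike.real_smul_eq_coe_mul]
  refine (h1.add hd).congr_of_eventuallyEq (Eventually.of_forall fun r => ?_)
  simp [inner_sub_left]

variable [CompleteSpace H]

namespace C0Group

theorem eq_of_forall_inner_generatorGraph (V : C0Group 𝕜 H) {a b : H}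
    (h : ∀ p ∈ V.generatorGraph, inner 𝕜 p.1 a = inner 𝕜 p.1 b) : a = b := by
  refine ext_inner_left 𝕜 fun x => ?_
  refine tendsto_nhds_unique ((V.tendsto_avg x).inner (𝕜 := 𝕜) (tendsto_const_nhds (x := a))) ?_
  refine ((V.tendsto_avg x).inner (𝕜 := 𝕜) (tendsto_const_nhds (x := b))).congr fun t => ?_
  exact (h _ (V.avg_mem_generatorGraph t x)).symm

theorem adj_adj (S : C0Group 𝕜 H) : S.adj.adj = S := by
  cases S
  simp [adj]

theorem scale_adj (S : C0Group 𝕜 H) (μ : ℝ) : (S.scale μ).adj = S.adj.scale μ := by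
  have : ∀ t, ((S.scale μ).adj).op t = (S.adj.scale μ).op t := by
    intro t
    change ContinuousLinearMap.adjoint (((Real.exp (μ * t) : ℝ) : 𝕜) • S.op t) = _
    rw [map_smulₛₗ, RCLike.conj_ofReal]
    rfl
  rw [C0Group.mk.injEq]
  exact funext this

theorem rev_adj (S : C0Group 𝕜 H) : S.rev.adj = S.adj.rev := rfl

theorem continuousOn_op_comp (S : C0Group 𝕜 H) {X : Type*} [TopologicalSpace X] {s : Set X}
    {a : X → ℝ} {f : X → H} (ha : ContinuousOn a s) (hf : ContinuousOn f s) :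
    ContinuousOn (fun x => S.op (a x) (f x)) s :=
  S.continuous_op_uncurry.comp_continuousOn (ha.prodMk hf)

/-- A weak solution of `z' = A z + g` is given by Duhamel's formula. Here `A` is the adjoint of the
generator of `V`. -/
theorem duhamel_of_weak (V : C0Group 𝕜 H) {T : ℝ} (hT : 0 < T) {z g : ℝ → H}
    (hz : ContinuousOn z (Icc 0 T)) (hg : ContinuousOn g (Icc 0 T))
    (hw : ∀ p ∈ V.generatorGraph, DistribDeriv T (fun t => inner 𝕜 p.1 (z t))
      (fun t => inner 𝕜 p.2 (z t) + inner 𝕜 p.1 (g t))) {t : ℝ} (ht : t ∈ Icc 0 T) :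
    z t = V.adj.op t (z 0) + ∫ s in (0 : ℝ)..t, V.adj.op (t - s) (g s) := by
  have hsub : Icc 0 t ⊆ Icc 0 T := Icc_subset_Icc_right ht.2
  have hgt := hg.mono hsub
  have hzt := hz.mono hsub
  have hint : IntervalIntegrable (fun s => V.adj.op (t - s) (g s)) volume 0 t :=
    (V.adj.continuousOn_op_comp (by fun_prop) hgt).intervalIntegrable_of_Icc ht.1
  refine V.eq_of_forall_inner_generatorGraph fun p hp => ?_
  -- The right-hand side of the weak equation is continuous, so the distributional derivative is a
  -- classical one.
  have hderiv : ∀ q ∈ V.generatorGraph, ∀ s ∈ Ioo 0 T,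
      HasDerivAt (fun r => inner 𝕜 q.1 (z r)) (inner 𝕜 q.2 (z s) + inner 𝕜 q.1 (g s)) s := by
    intro q hq s hs
    have hc : ContinuousOn (fun t => inner 𝕜 q.2 (z t) + inner 𝕜 q.1 (g t)) (Icc 0 T) := by
      fun_prop
    have he := (hw q hq).eq_add_integral hT (by fun_prop) hc
    have hd : HasDerivAt (fun t => ∫ r in (0 : ℝ)..t, (inner 𝕜 q.2 (z r) + inner 𝕜 q.1 (g r)))
        (inner 𝕜 q.2 (z s) + inner 𝕜 q.1 (g s)) s :=
      intervalIntegral.integral_hasDerivAt_right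
        ((hc.mono (Icc_subset_Icc_right hs.2.le)).intervalIntegrable_of_Icc hs.1.le)
        ((hc.mono Ioo_subset_Icc_self).stronglyMeasurableAtFilter isOpen_Ioo s hs)
        (hc.continuousAt (Icc_mem_nhds hs.1 hs.2))
    refine (hd.const_add (inner 𝕜 q.1 (z 0))).congr_of_eventuallyEq ?_
    filter_upwards [Icc_mem_nhds hs.1 hs.2] with r hr using he r hr
  -- Differentiate $s\mapsto\langle V(t-s)p,z(s)\rangle$: the two generator terms cancel and only
  -- the source remains.
  have hF := intervalIntegral.integral_eq_sub_of_hasDerivAt_of_le ht.1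
    (f := fun s => inner 𝕜 (V.op (t - s) p.1) (z s))
    (f' := fun s => inner 𝕜 (V.op (t - s) p.1) (g s))
    ((V.continuousOn_op_comp (by fun_prop) continuousOn_const).inner hzt)
    (fun s hs => by
      have h1 : HasDerivAt (fun r => V.op (t - r) p.1) (-V.op (t - s) p.2) s := by
        have := (V.hasDerivAt_op hp (t - s)).scomp s ((hasDerivAt_id s).const_sub t)
        rw [neg_one_smul] at this
        exact this
      have hsT : s ∈ Ioo 0 T := ⟨hs.1, hs.2.trans_le ht.2⟩
      have h2 := hasDerivAt_inner_of_weak h1 (hz.continuousAt (Icc_mem_nhds hsT.1 hsT.2))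
        (hderiv _ (V.op_mem_generatorGraph (t - s) hp) s hsT)
      simpa using h2)
    (((V.continuousOn_op_comp (by fun_prop) continuousOn_const).inner
      hgt).intervalIntegrable_of_Icc ht.1)
  rw [inner_add_right, inner_intervalIntegral hint]
  simp only [adj_op, ContinuousLinearMap.adjoint_inner_right]
  rw [hF]
  simp [op_zero_apply]

end C0Group

variable {S : C0Group 𝕜 H} {T : ℝ} {g z g' z' : ℝ → H}

/-- The time-reversed group is generated by $-A$, which brings the weak equation to the form
required by `C0Group.duhamel_of_weak`. -/
theorem IsAdjWeakSol.distribDeriv_rev (h : IsAdjWeakSol S T g z) {p : H × H}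
    (hp : p ∈ S.rev.generatorGraph) :
    DistribDeriv T (fun t => inner 𝕜 p.1 (z t))
      (fun t => inner 𝕜 p.2 (z t) + inner 𝕜 p.1 (g t)) := by
  have h1 := S.rev.mem_generatorGraph_rev hp
  rw [C0Group.rev_rev, ← C0Group.generator_graph, LinearPMap.mem_graph_iff] at h1
  obtain ⟨ψ, h2, h3⟩ := h1
  have := h.2 ψ
  simp only at h2 h3
  rw [h2, h3] at this
  simpa using this

theorem isAdjWeakSol_iff : IsAdjWeakSol S T g z ↔ ContinuousOn z (Icc 0 T) ∧
    ∀ p ∈ S.rev.generatorGraph, DistribDeriv T (fun t => inner 𝕜 p.1 (z t))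
      (fun t => inner 𝕜 p.2 (z t) + inner 𝕜 p.1 (g t)) := by
  refine ⟨fun h => ⟨h.1, fun p hp => h.distribDeriv_rev hp⟩, fun h => ⟨h.1, fun ψ => ?_⟩⟩
  have h1 : ((ψ : H), S.generator ψ) ∈ S.generatorGraph := by
    rw [← C0Group.generator_graph]; exact LinearPMap.mem_graph _ ψ
  have := h.2 _ (S.mem_generatorGraph_rev h1)
  simpa using this

theorem IsAdjWeakSol.duhamel (hT : 0 < T) (h : IsAdjWeakSol S T g z)
    (hg : ContinuousOn g (Icc 0 T)) {t : ℝ} (ht : t ∈ Icc 0 T) :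
    z t = S.adj.rev.op t (z 0) + ∫ s in (0 : ℝ)..t, S.adj.rev.op (t - s) (g s) :=
  S.rev.duhamel_of_weak hT h.1 hg (fun _ hp => h.distribDeriv_rev hp) ht

/-- Continuous dependence of weak solutions on their data. -/
theorem IsAdjWeakSol.norm_sub_le (hT : 0 < T) (h : IsAdjWeakSol S T g z)
    (h' : IsAdjWeakSol S T g' z') (hg : ContinuousOn g (Icc 0 T))
    (hg' : ContinuousOn g' (Icc 0 T)) {M : ℝ} (hM : ∀ t : ℝ, |t| ≤ T → ‖S.adj.rev.op t‖ ≤ M)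
    {t : ℝ} (ht : t ∈ Icc 0 T) :
    ‖z t - z' t‖ ≤ M * (‖z 0 - z' 0‖ + ∫ s in (0 : ℝ)..T, ‖g s - g' s‖) := by
  have hsub : Icc 0 t ⊆ Icc 0 T := Icc_subset_Icc_right ht.2
  have hint : ∀ f : ℝ → H, ContinuousOn f (Icc 0 T) →
      IntervalIntegrable (fun s => S.adj.rev.op (t - s) (f s)) volume 0 t := fun f hf =>
    (S.adj.rev.continuousOn_op_comp (by fun_prop) (hf.mono hsub)).intervalIntegrable_of_Icc ht.1
  have hM0 : 0 ≤ M := (norm_nonneg _).trans (hM 0 (by simpa using hT.le))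
  have e : z t - z' t = S.adj.rev.op t (z 0 - z' 0)
      + ∫ s in (0 : ℝ)..t, S.adj.rev.op (t - s) (g s - g' s) := by
    rw [h.duhamel hT hg ht, h'.duhamel hT hg' ht]
    simp only [map_sub]
    rw [intervalIntegral.integral_sub (hint g hg) (hint g' hg')]
    abel
  have hn : ContinuousOn (fun s => ‖g s - g' s‖) (Icc 0 T) := (hg.sub hg').norm
  have b : ‖∫ s in (0 : ℝ)..t, S.adj.rev.op (t - s) (g s - g' s)‖
      ≤ M * ∫ s in (0 : ℝ)..T, ‖g s - g' s‖ := by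
    calc _ ≤ ∫ s in (0 : ℝ)..t, M * ‖g s - g' s‖ := by
          refine intervalIntegral.norm_integral_le_of_norm_le ht.1 ?_
            (((hn.mono hsub).intervalIntegrable_of_Icc ht.1).const_mul M)
          refine Eventually.of_forall fun s hs => ?_
          refine ContinuousLinearMap.le_of_opNorm_le _ (hM _ ?_) _
          rw [abs_of_nonneg (by linarith [hs.2])]
          linarith [hs.1, ht.2]
      _ = M * ∫ s in (0 : ℝ)..t, ‖g s - g' s‖ := intervalIntegral.integral_const_mul _ _
      _ ≤ _ := by
          refine mul_le_mul_of_nonneg_left ?_ hM0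
          refine intervalIntegral.integral_mono_interval le_rfl ht.1 ht.2
            (Eventually.of_forall fun _ => norm_nonneg _) (hn.intervalIntegrable_of_Icc hT.le)
  rw [e, mul_add]
  refine (norm_add_le _ _).trans (add_le_add ?_ b)
  exact ContinuousLinearMap.le_of_opNorm_le _ (hM _ (by rw [abs_of_nonneg ht.1]; exact ht.2)) _

end MildFormula

/-! ### Limits in $L^p$ seminorms -/

section ELpNormLimits

variable {𝕜 E F : Type*} [RCLike 𝕜] [NormedAddCommGroup E] [NormedSpace 𝕜 E]
  [NormedAddCommGroup F] [NormedSpace 𝕜 F] {α : Type*} [MeasurableSpace α] {μ : Measure α}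
  {p : ENNReal}

theorem tendsto_eLpNorm_clm (L : E →L[𝕜] F) {f : α → E} {fs : ℕ → α → E}
    (h : Tendsto (fun n => eLpNorm (fun t => fs n t - f t) p μ) atTop (𝓝 0)) :
    Tendsto (fun n => eLpNorm (fun t => L (fs n t) - L (f t)) p μ) atTop (𝓝 0) := by
  have h0 : Tendsto (fun n => ENNReal.ofReal ‖L‖ * eLpNorm (fun t => fs n t - f t) p μ)
      atTop (𝓝 0) := by
    have := ENNReal.Tendsto.const_mul h (Or.inr (ENNReal.ofReal_ne_top (r := ‖L‖)))
    rwa [mul_zero] at this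
  refine tendsto_of_tendsto_of_tendsto_of_le_of_le tendsto_const_nhds h0
    (fun _ => zero_le) fun n => ?_
  refine eLpNorm_le_mul_eLpNorm_of_ae_le_mul (Eventually.of_forall fun t => ?_) p
  rw [← map_sub]
  exact L.le_opNorm _

theorem tendsto_eLpNorm_add (hp : 1 ≤ p) {f g : α → E} {fs gs : ℕ → α → E}
    (hf : AEStronglyMeasurable f μ) (hg : AEStronglyMeasurable g μ)
    (hfs : ∀ n, AEStronglyMeasurable (fs n) μ) (hgs : ∀ n, AEStronglyMeasurable (gs n) μ)
    (h : Tendsto (fun n => eLpNorm (fun t => fs n t - f t) p μ) atTop (𝓝 0))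
    (h' : Tendsto (fun n => eLpNorm (fun t => gs n t - g t) p μ) atTop (𝓝 0)) :
    Tendsto (fun n => eLpNorm (fun t => (fs n t + gs n t) - (f t + g t)) p μ) atTop (𝓝 0) := by
  have h0 := h.add h'
  rw [add_zero] at h0
  refine tendsto_of_tendsto_of_tendsto_of_le_of_le tendsto_const_nhds h0
    (fun _ => zero_le) fun n => ?_
  have e : (fun t => (fs n t + gs n t) - (f t + g t))
      = (fun t => fs n t - f t) + (fun t => gs n t - g t) := by
    ext t; simp; abel
  rw [e]
  exact eLpNorm_add_le ((hfs n).sub hf) ((hgs n).sub hg) hp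

theorem tendsto_eLpNorm_one_of_two [IsFiniteMeasure μ] {f : α → E} {fs : ℕ → α → E}
    (hf : AEStronglyMeasurable f μ) (hfs : ∀ n, AEStronglyMeasurable (fs n) μ)
    (h : Tendsto (fun n => eLpNorm (fun t => fs n t - f t) 2 μ) atTop (𝓝 0)) :
    Tendsto (fun n => eLpNorm (fun t => fs n t - f t) 1 μ) atTop (𝓝 0) := by
  have h0 : Tendsto (fun n => eLpNorm (fun t => fs n t - f t) 2 μ *
      μ univ ^ (1 / (1 : ENNReal).toReal - 1 / (2 : ENNReal).toReal)) atTop (𝓝 0) := by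
    have hne : μ univ ^ (1 / (1 : ENNReal).toReal - 1 / (2 : ENNReal).toReal) ≠ ⊤ :=
      ENNReal.rpow_ne_top_of_nonneg (by norm_num) (measure_ne_top _ _)
    simpa using ENNReal.Tendsto.mul_const h (Or.inr hne)
  refine tendsto_of_tendsto_of_tendsto_of_le_of_le tendsto_const_nhds h0
    (fun _ => zero_le) fun n => ?_
  exact eLpNorm_le_eLpNorm_mul_rpow_measure_univ (by norm_num) ((hfs n).sub hf)

theorem tendsto_eLpNorm_of_norm_le [IsFiniteMeasure μ] {f : α → E} {fs : ℕ → α → E}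
    {c : ℕ → ℝ} (hc : Tendsto c atTop (𝓝 0)) (h : ∀ n, ∀ᵐ t ∂μ, ‖fs n t - f t‖ ≤ c n) :
    Tendsto (fun n => eLpNorm (fun t => fs n t - f t) p μ) atTop (𝓝 0) := by
  have h0 : Tendsto (fun n => μ univ ^ p.toReal⁻¹ * ENNReal.ofReal (c n)) atTop (𝓝 0) := by
    have hne : μ univ ^ p.toReal⁻¹ ≠ ⊤ :=
      ENNReal.rpow_ne_top_of_nonneg (by positivity) (measure_ne_top _ _)
    have := ENNReal.tendsto_ofReal hc
    rw [ENNReal.ofReal_zero] at this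
    simpa using ENNReal.Tendsto.const_mul this (Or.inr hne)
  refine tendsto_of_tendsto_of_tendsto_of_le_of_le tendsto_const_nhds h0
    (fun _ => zero_le) fun n => ?_
  exact eLpNorm_le_of_ae_bound (h n)

theorem tendsto_intervalIntegral_norm {T : ℝ} (hT : 0 ≤ T) {f : ℝ → E} {fs : ℕ → ℝ → E}
    (hf : ContinuousOn f (Icc 0 T)) (hfs : ∀ n, ContinuousOn (fs n) (Icc 0 T))
    (h : Tendsto (fun n => eLpNorm (fun t => fs n t - f t) 1 (volume.restrict (Ioc 0 T)))
      atTop (𝓝 0)) :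
    Tendsto (fun n => ∫ t in (0 : ℝ)..T, ‖fs n t - f t‖) atTop (𝓝 0) := by
  have := (ENNReal.tendsto_toReal ENNReal.zero_ne_top).comp h
  refine this.congr fun n => ?_
  rw [intervalIntegral.integral_of_le hT, integral_norm_eq_lintegral_enorm]
  · simp only [Function.comp, eLpNorm_one_eq_lintegral_enorm]
  · exact (((hfs n).sub hf).mono Ioc_subset_Icc_self).aestronglyMeasurable measurableSet_Ioc

end ELpNormLimits

/-! ### The observation $B^*z$: observability and the equation for $Qz$ -/

section Observation

variable {𝕜 H U : Type*} [RCLike 𝕜]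
  [NormedAddCommGroup H] [InnerProductSpace 𝕜 H] [CompleteSpace H]
  [NormedAddCommGroup U] [InnerProductSpace 𝕜 U] [CompleteSpace U] {S : C0Group 𝕜 H}

/-- The inclusion `D(A*) ⊂ H` as a continuous linear map. -/
def C0Group.adjInclL (S : C0Group 𝕜 H) : S.adjDom →L[𝕜] H :=
  (WithLp.fstL 2 𝕜 H H).comp S.adjDom.subtypeL

/-- `A*` as a continuous linear map on `D(A*)`. -/
def C0Group.adjGenL (S : C0Group 𝕜 H) : S.adjDom →L[𝕜] H :=
  (WithLp.sndL 2 𝕜 H H).comp S.adjDom.subtypeL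

/-- `B*` as a continuous linear map on `D(A*)`. -/
def ControlOp.starL (B : ControlOp S U) : S.adjDom →L[𝕜] U :=
  LinearMap.mkContinuous
    { toFun := ControlOp.star B
      map_add' := fun x y => by simp [ControlOp.star]
      map_smul' := fun c x => by
        simp only [ControlOp.star, map_smulₛₗ, RingHom.id_apply]
        rw [starRingEnd_self_apply] } ‖ContinuousLinearMap.flip B‖ (by
    intro z
    change ‖(InnerProductSpace.toDual 𝕜 U).symm (ContinuousLinearMap.flip B z)‖ ≤ _
    rw [LinearIsometryEquiv.norm_map]
    exact (ContinuousLinearMap.flip B).le_opNorm z)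

theorem ControlOp.starL_apply (B : ControlOp S U) (z : S.adjDom) :
    ControlOp.starL B z = ControlOp.star B z := rfl

theorem memLp_of_continuousOn {E : Type*} [NormedAddCommGroup E] {T : ℝ} {f : ℝ → E}
    {p : ENNReal} (hf : ContinuousOn f (Icc 0 T)) : MemLp f p (volume.restrict (Ioc 0 T)) := by
  obtain ⟨C, hC⟩ := isCompact_Icc.exists_bound_of_continuousOn hf
  refine MemLp.of_bound ((hf.mono Ioc_subset_Icc_self).aestronglyMeasurable measurableSet_Ioc) C ?_
  filter_upwards [ae_restrict_mem measurableSet_Ioc] with t ht using hC t (Ioc_subset_Icc_self ht)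

theorem aestronglyMeasurable_of_continuousOn {E : Type*} [NormedAddCommGroup E] {T : ℝ}
    {f : ℝ → E} (hf : ContinuousOn f (Icc 0 T)) :
    AEStronglyMeasurable f (volume.restrict (Ioc 0 T)) :=
  (memLp_of_continuousOn (p := 1) hf).1

theorem norm_toLp_sq {E : Type*} [NormedAddCommGroup E] {T : ℝ} (hT : 0 ≤ T) {f : ℝ → E}
    (hf : MemLp f 2 (volume.restrict (Ioc 0 T))) :
    ‖hf.toLp f‖ ^ 2 = ∫ t in (0 : ℝ)..T, ‖f t‖ ^ 2 := by
  rw [Lp.norm_toLp, eLpNorm_eq_lintegral_rpow_enorm_toReal (by norm_num) (by norm_num),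
    intervalIntegral.integral_of_le hT, integral_eq_lintegral_of_nonneg_ae (f := fun t => ‖f t‖ ^ 2)
      (Eventually.of_forall fun _ => by positivity) (hf.1.norm.pow 2),
    ← ENNReal.toReal_pow, ← ENNReal.rpow_natCast, ← ENNReal.rpow_mul]
  norm_num

variable [NormedSpace ℝ H] [IsScalarTower ℝ 𝕜 H]

/-- Duality. Admissibility says that pairing $s\mapsto B^*S(T-s)^*z$ with a fixed $u\in L^2$ gives
$\langle z,\varphi(T)\rangle$, which is bounded by $\|z\|_{\mathbb H}$ times a constant depending on
$u$. The uniform boundedness principle on $L^2$ removes this dependence. -/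
theorem IsAdmissible.exists_observability {B : ControlOp S U} (hB : IsAdmissible S B) {T : ℝ}
    (hT : 0 < T) :
    ∃ K : ℝ, 0 ≤ K ∧ ∀ z : S.adjDom,
      ∫ t in (0 : ℝ)..T, ‖ControlOp.star B (S.adjOp (-t) z)‖ ^ 2 ≤ K * ‖S.adjIncl z‖ ^ 2 := by
  have hc : ∀ z : S.adjDom, ContinuousOn (fun s => ControlOp.star B (S.adjOp (T - s) z))
      (Icc 0 T) := fun z => ((ControlOp.starL B).continuous.comp
        (S.continuous_adjOp (by fun_prop) z)).continuousOn
  have hm := fun z => memLp_of_continuousOn (p := 2) (hc z)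
  let F : S.adjDom → Lp U 2 (volume.restrict (Ioc 0 T)) := fun z => (hm z).toLp
  have hF : ∀ u : Lp U 2 (volume.restrict (Ioc 0 T)), ∃ y : H, ∀ z : S.adjDom,
      inner 𝕜 (F z) u = inner 𝕜 (S.adjIncl z) y := by
    intro u
    obtain ⟨φ, -, hφ⟩ := hB T hT u (Lp.memLp u)
    refine ⟨φ T, fun z => ?_⟩
    rw [hφ T ⟨hT.le, le_rfl⟩ z, L2.inner_def, intervalIntegral.integral_of_le hT.le]
    refine integral_congr_ae ?_
    filter_upwards [(hm z).coeFn_toLp] with s hs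
    rw [hs, ControlOp.inner_star]
  -- The functionals on $L^2$ are indexed by $z$ and normalised by $\|z\|_{\mathbb H}$, not by the
  -- graph norm.
  obtain ⟨C, hC⟩ := banach_steinhaus
    (g := fun z : S.adjDom => (((‖S.adjIncl z‖⁻¹ : ℝ) : 𝕜)) • innerSL 𝕜 (F z)) (by
      intro u
      obtain ⟨y, hy⟩ := hF u
      refine ⟨‖y‖, fun z => ?_⟩
      rw [smul_apply, innerSL_apply_apply, hy, norm_smul, RCLike.norm_ofReal, abs_inv,
        abs_norm]
      refine (mul_le_mul_of_nonneg_left (norm_inner_le_norm _ _) (by positivity)).trans ?_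
      rw [← mul_assoc]
      exact mul_le_of_le_one_left (norm_nonneg _) (inv_mul_le_one))
  have hC0 : 0 ≤ C := (norm_nonneg _).trans (hC 0)
  have hFn : ∀ z, ‖F z‖ ≤ C * ‖S.adjIncl z‖ := by
    intro z
    -- For $z=0$ the normalisation factor is $0^{-1}=0$ and carries no information; here $F(z)$ is
    -- orthogonal to itself.
    rcases eq_or_ne (S.adjIncl z) 0 with h0 | h0
    · obtain ⟨y, hy⟩ := hF (F z)
      have := hy z
      rw [h0, inner_zero_left, inner_self_eq_zero] at this
      rw [this, h0]; simp
    · have := hC z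
      rw [norm_smul, RCLike.norm_ofReal, abs_inv, abs_norm, innerSL_apply_norm,
        inv_mul_le_iff₀ (norm_pos_iff.2 h0)] at this
      linarith
  -- Replacing $z$ by $S(-T)^*z$ turns $S(T-s)^*$ into $S(-s)^*$, at the cost of the factor
  -- $\|S(-T)^*\|$.
  refine ⟨(C * ‖S.adj.op (-T)‖) ^ 2, by positivity, fun z => ?_⟩
  have h1 := norm_toLp_sq hT.le (hm (S.adjOp (-T) z))
  have e : ∀ s, S.adjOp (T - s) (S.adjOp (-T) z) = S.adjOp (-s) z := by
    intro s; rw [C0Group.adjOp_adjOp]; congr 1; ring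
  simp only [e] at h1
  rw [← h1, ← mul_pow]
  refine pow_le_pow_left₀ (norm_nonneg _) ?_ 2
  have h2 := hFn (S.adjOp (-T) z)
  simp only [F, e] at h2
  refine h2.trans ?_
  rw [mul_assoc, C0Group.adjIncl_adjOp]
  exact mul_le_mul_of_nonneg_left (ContinuousLinearMap.le_opNorm _ _) hC0

theorem C0Group.distribDeriv_of_forall_generatorGraph (V : C0Group 𝕜 H) {T : ℝ} {f h : ℝ → H}
    (hf : IntervalIntegrable f volume 0 T) (hh : IntervalIntegrable h volume 0 T)
    (H' : ∀ p ∈ V.generatorGraph,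
      DistribDeriv T (fun t => inner 𝕜 p.1 (f t)) (fun t => inner 𝕜 p.1 (h t))) (x : H) :
    DistribDeriv T (fun t => inner 𝕜 x (f t)) (fun t => inner 𝕜 x (h t)) := by
  intro θ hθ hc hs
  have hi : ∀ (η : ℝ → ℝ) (u : ℝ → H), Continuous η → IntervalIntegrable u volume 0 T → ∀ y : H,
      ∫ t in (0 : ℝ)..T, ((η t : ℝ) : 𝕜) * inner 𝕜 y (u t)
        = inner 𝕜 y (∫ t in (0 : ℝ)..T, η t • u t) := by
    intro η u hη hu y
    rw [inner_intervalIntegral (hu.continuousOn_smul hη.continuousOn)]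
    congr 1
    ext t
    rw [RCLike.real_smul_eq_coe_smul (K := 𝕜), inner_smul_right]
  have c1 := hθ.continuous
  have c2 := hθ.continuous_deriv (by simp)
  rw [hi _ _ c2 hf, hi _ _ c1 hh, ← inner_neg_right]
  congr 1
  refine V.eq_of_forall_inner_generatorGraph fun p hp => ?_
  rw [inner_neg_right, ← hi _ _ c2 hf, ← hi _ _ c1 hh]
  exact H' p hp θ hθ hc hs

variable {T : ℝ}

/-- For $\mathcal D(A^*)$-valued solutions the operator $A^*$ can act on the solution, so density of
$\mathcal D(A)$ allows every test vector in $\mathbb H$. This matters because $Q\varphi$ need not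
lie in $\mathcal D(A)$. -/
theorem IsAdjWeakSol.distribDeriv_adjDom (hT : 0 ≤ T) {g Z : ℝ → S.adjDom}
    (hg : ContinuousOn g (Icc 0 T)) (hZ : ContinuousOn Z (Icc 0 T))
    (h : IsAdjWeakSol S T (fun t => S.adjIncl (g t)) (fun t => S.adjIncl (Z t))) (x : H) :
    DistribDeriv T (fun t => inner 𝕜 x (S.adjIncl (Z t)))
      (fun t => inner 𝕜 x (S.adjIncl (g t) - S.adjGen (Z t))) := by
  refine S.rev.distribDeriv_of_forall_generatorGraph
    (f := fun t => S.adjIncl (Z t)) (h := fun t => S.adjIncl (g t) - S.adjGen (Z t)) (h.1.intervalIntegrable_of_Icc hT)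
    (ContinuousOn.intervalIntegrable_of_Icc hT
      ((S.adjInclL.continuous.comp_continuousOn hg).sub
        (S.adjGenL.continuous.comp_continuousOn hZ))) (fun p hp => ?_) x
  refine (h.distribDeriv_rev hp).congr hT (fun _ _ => rfl) fun t _ => ?_
  have h1 := S.rev.mem_generatorGraph_rev hp
  rw [C0Group.rev_rev] at h1
  have h2 := S.inner_generator_adjDom (Z t) h1
  rw [inner_neg_left] at h2
  rw [inner_sub_right, ← h2]
  ring

/-- This is the rigorous form of $(Qz)'=AQz-BWB^*z+2\lambda Qz+Qg$, tested against
$\varphi\in\mathcal D(A^*)$. It holds for the approximations by the operator identity. In the limit,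
$Z_n\to z$ uniformly by continuous dependence, $g_n\to g$ in $L^1$ and $B^*Z_n\to v$ in $L^2$, hence
in $L^1$. -/
theorem IsAdjObservation.distribDeriv {B : ControlOp S U} {Q : H →L[𝕜] H} {W : U →L[𝕜] U}
    {lam : ℝ} (hid : OperatorIdentity S B Q 0 W lam)
    (hT : 0 < T) {g z : ℝ → H} {v : ℝ → U} (hg : ContinuousOn g (Icc 0 T))
    (hz : IsAdjWeakSol S T g z) (hv : IsAdjObservation S B T g z v) (φ : S.adjDom) :
    DistribDeriv T (fun t => inner 𝕜 (Q (S.adjIncl φ)) (z t))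
      (fun t => inner 𝕜 (S.adjGen φ) (Q (z t))
        + ((2 * lam : ℝ) : 𝕜) * inner 𝕜 (Q (S.adjIncl φ)) (z t)
        + inner 𝕜 (Q (S.adjIncl φ)) (g t)
        - inner 𝕜 (W (ControlOp.star B φ)) (v t)) := by
  obtain ⟨hvm, gs, Zs, hgs, hZs, hsol, h0, hgl, hvl⟩ := hv
  let μ := volume.restrict (Ioc 0 T)
  have hgs' : ∀ n, ContinuousOn (fun t => S.adjIncl (gs n t)) (Icc 0 T) := fun n =>
    S.adjInclL.continuous.comp_continuousOn (hgs n)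
  have hBs : ∀ n, ContinuousOn (fun t => ControlOp.star B (Zs n t)) (Icc 0 T) := fun n =>
    (ControlOp.starL B).continuous.comp_continuousOn (hZs n)
  obtain ⟨M, hM0, hM⟩ := S.adj.rev.exists_op_bound T
  have hZl : Tendsto (fun n => eLpNorm (fun t => S.adjIncl (Zs n t) - z t) 1 μ) atTop (𝓝 0) := by
    have h1 := tendsto_intervalIntegral_norm hT.le hg hgs' hgl
    have h2 := (((tendsto_iff_norm_sub_tendsto_zero.1 h0).add h1).const_mul M)
    rw [add_zero, mul_zero] at h2
    refine tendsto_eLpNorm_of_norm_le h2 fun n => ?_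
    filter_upwards [ae_restrict_mem measurableSet_Ioc] with t ht
    exact (hsol n).norm_sub_le hT hz (hgs' n) hg hM (Ioc_subset_Icc_self ht)
  have hvl1 := tendsto_eLpNorm_one_of_two hvm.1 (fun n => aestronglyMeasurable_of_continuousOn (hBs n)) hvl
  let L1 : H →L[𝕜] 𝕜 := (innerSL 𝕜 (S.adjGen φ)).comp Q
    + ((2 * lam : ℝ) : 𝕜) • innerSL 𝕜 (Q (S.adjIncl φ))
  let L2 : H →L[𝕜] 𝕜 := innerSL 𝕜 (Q (S.adjIncl φ))
  let L3 : U →L[𝕜] 𝕜 := -innerSL 𝕜 (W (ControlOp.star B φ))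
  have key : DistribDeriv T (fun t => L2 (z t)) (fun t => L1 (z t) + L2 (g t) + L3 (v t)) := by
    have i1 : ∀ n, ContinuousOn (fun t => L1 (S.adjIncl (Zs n t))) (Icc 0 T) := fun n =>
      L1.continuous.comp_continuousOn (hsol n).1
    have i2 : ∀ n, ContinuousOn (fun t => L2 (S.adjIncl (gs n t))) (Icc 0 T) := fun n =>
      L2.continuous.comp_continuousOn (hgs' n)
    have i3 : ∀ n, ContinuousOn (fun t => L3 (ControlOp.star B (Zs n t))) (Icc 0 T) := fun n =>
      L3.continuous.comp_continuousOn (hBs n)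
    have j1 := L1.continuous.comp_continuousOn hz.1
    have j2 := L2.continuous.comp_continuousOn hg
    have j3 : MemLp (fun t => L3 (v t)) 2 μ := L3.comp_memLp' hvm
    refine DistribDeriv.of_tendsto hT.le (F := fun n t => L2 (S.adjIncl (Zs n t)))
      (G := fun n t => L1 (S.adjIncl (Zs n t)) + L2 (S.adjIncl (gs n t))
        + L3 (ControlOp.star B (Zs n t))) ?_ ?_ ?_ ?_ ?_ ?_ ?_
    · exact fun n => (L2.continuous.comp_continuousOn (hsol n).1).intervalIntegrable_of_Icc hT.le
    · exact (L2.continuous.comp_continuousOn hz.1).intervalIntegrable_of_Icc hT.le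
    · exact fun n => (((i1 n).add (i2 n)).add (i3 n)).intervalIntegrable_of_Icc hT.le
    · refine ((j1.add j2).intervalIntegrable_of_Icc hT.le).add ?_
      rw [intervalIntegrable_iff_integrableOn_Ioc_of_le hT.le]
      exact j3.integrable (by norm_num)
    · exact tendsto_eLpNorm_clm L2 hZl
    · exact tendsto_eLpNorm_add le_rfl ((aestronglyMeasurable_of_continuousOn j1).add (aestronglyMeasurable_of_continuousOn j2)) j3.1
        (fun n => (aestronglyMeasurable_of_continuousOn (i1 n)).add (aestronglyMeasurable_of_continuousOn (i2 n))) (fun n => aestronglyMeasurable_of_continuousOn (i3 n))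
        (tendsto_eLpNorm_add le_rfl (aestronglyMeasurable_of_continuousOn j1) (aestronglyMeasurable_of_continuousOn j2) (fun n => aestronglyMeasurable_of_continuousOn (i1 n))
          (fun n => aestronglyMeasurable_of_continuousOn (i2 n)) (tendsto_eLpNorm_clm L1 hZl) (tendsto_eLpNorm_clm L2 hgl))
        (tendsto_eLpNorm_clm L3 hvl1)
    · intro n
      refine ((hsol n).distribDeriv_adjDom hT.le (hgs n) (hZs n) (Q (S.adjIncl φ))).congr hT.le
        (fun _ _ => rfl) fun t _ => ?_
      -- The operator identity removes $\langle Q\varphi,A^*Z_n\rangle$, the only term not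
      -- continuous in $Z_n$ for the norm of $\mathbb H$, in favour of $B^*Z_n$.
      have := hid φ (Zs n t)
      simp only [zero_apply, inner_zero_left, add_zero] at this
      simp only [L1, L2, L3, add_apply, smul_apply, neg_apply, ContinuousLinearMap.comp_apply,
        innerSL_apply_apply, smul_eq_mul, inner_sub_right]
      linear_combination -this
  refine key.congr hT.le (fun _ _ => rfl) fun t _ => ?_
  simp only [L1, L2, L3, add_apply, smul_apply, neg_apply, ContinuousLinearMap.comp_apply,
    innerSL_apply_apply, smul_eq_mul]
  ring

end Observation

/-! ### Existence of the observation for mild solutions -/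

theorem sq_intervalIntegral_le {T : ℝ} (hT : 0 < T) {φ : ℝ → ℝ} (hφ : Continuous φ) :
    (∫ t in (0 : ℝ)..T, φ t) ^ 2 ≤ T * ∫ t in (0 : ℝ)..T, φ t ^ 2 := by
  set I := ∫ t in (0 : ℝ)..T, φ t with hI
  -- Cauchy–Schwarz appears here as nonnegativity of the variance about the mean $I/T$.
  have h0 : 0 ≤ ∫ t in (0 : ℝ)..T, (φ t - I / T) ^ 2 :=
    intervalIntegral.integral_nonneg hT.le fun _ _ => sq_nonneg _
  have e : ∀ t, (φ t - I / T) ^ 2 = φ t ^ 2 - 2 * (I / T) * φ t + (I / T) ^ 2 := fun t => by ring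
  have i1 : IntervalIntegrable (fun t => φ t ^ 2) volume 0 T :=
    (hφ.pow 2).intervalIntegrable _ _
  have i2 : IntervalIntegrable (fun t => 2 * (I / T) * φ t) volume 0 T :=
    (hφ.const_mul _).intervalIntegrable _ _
  simp only [e] at h0
  rw [intervalIntegral.integral_add (i1.sub i2) intervalIntegrable_const,
    intervalIntegral.integral_sub i1 i2, intervalIntegral.integral_const_mul, ← hI,
    intervalIntegral.integral_const, sub_zero, smul_eq_mul] at h0
  have e2 : 2 * (I / T) * I = 2 * (I ^ 2 / T) := by ring
  have e3 : T * (I / T) ^ 2 = I ^ 2 / T := by field_simp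
  rw [e2, e3] at h0
  rw [mul_comm, ← div_le_iff₀ hT]
  linarith

section Existence

variable {𝕜 H U : Type*} [RCLike 𝕜]
  [NormedAddCommGroup H] [InnerProductSpace 𝕜 H] [CompleteSpace H]
  [NormedAddCommGroup U] [InnerProductSpace 𝕜 U] [CompleteSpace U]
  [NormedSpace ℝ H] [IsScalarTower ℝ 𝕜 H]

namespace C0Group

/-- The mild solution `G(t) x₀ + ∫₀ᵗ G(t - s) f(s) ds`. -/
def mild (G : C0Group 𝕜 H) (x₀ : H) (f : ℝ → H) (t : ℝ) : H :=
  G.op t (x₀ + ∫ s in (0 : ℝ)..t, G.op (-s) (f s))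

variable (G : C0Group 𝕜 H) {x₀ : H} {f : ℝ → H}

theorem mild_zero : G.mild x₀ f 0 = x₀ := by
  simp [mild, op_zero_apply]

theorem hasDerivAt_mild_aux (hf : Continuous f) (t : ℝ) :
    HasDerivAt (fun t => x₀ + ∫ s in (0 : ℝ)..t, G.op (-s) (f s)) (G.op (-t) (f t)) t := by
  have hc : Continuous fun s => G.op (-s) (f s) := G.continuous_op_comp continuous_neg hf
  exact (intervalIntegral.integral_hasDerivAt_right (hc.intervalIntegrable _ _)
    hc.stronglyMeasurable.stronglyMeasurableAtFilter hc.continuousAt).const_add _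

theorem continuous_mild (hf : Continuous f) : Continuous (G.mild x₀ f) :=
  G.continuous_op_comp continuous_id
    (continuous_iff_continuousAt.2 fun t => (G.hasDerivAt_mild_aux hf t).continuousAt)

/-- Moving the group onto $p$ gives a product of two differentiable curves, although the mild
solution itself need not be differentiable. -/
theorem hasDerivAt_inner_mild (V : C0Group 𝕜 H) (hf : Continuous f) {p : H × H}
    (hp : p ∈ V.generatorGraph) (t : ℝ) :
    HasDerivAt (fun t => inner 𝕜 p.1 (V.adj.mild x₀ f t))
      (inner 𝕜 p.2 (V.adj.mild x₀ f t) + inner 𝕜 p.1 (f t)) t := by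
  have h := (V.hasDerivAt_op hp t).inner 𝕜 (V.adj.hasDerivAt_mild_aux (x₀ := x₀) hf t)
  simp only [mild, adj_op, ContinuousLinearMap.adjoint_inner_right] at h ⊢
  convert h using 1
  rw [op_neg_op]
  ring

/-- Since $G$ is a group, the Duhamel term at time $t$ is $\int_0^tG(t)k(s)\,ds$ with
$k(s)=G(-s)f(s)$, a superposition of orbits started at time $0$. Extending the integral of the norm
to $[0,T]$, then Cauchy–Schwarz and Fubini, reduces the bound to the homogeneous estimate at $x_0$
and at each $k(s)$. -/
theorem integral_norm_sq_mild_le (C : H →L[𝕜] U) (D : H →L[𝕜] H) {T K : ℝ} (hT : 0 < T)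
    (hK : ∀ x, ∫ t in (0 : ℝ)..T, ‖C (G.op t x)‖ ^ 2 ≤ K * ‖D x‖ ^ 2) (hf : Continuous f) :
    ∫ t in (0 : ℝ)..T, ‖C (G.mild x₀ f t)‖ ^ 2 ≤
      2 * K * (‖D x₀‖ ^ 2 + T * ∫ s in (0 : ℝ)..T, ‖D (G.op (-s) (f s))‖ ^ 2) := by
  let k : ℝ → H := fun s => G.op (-s) (f s)
  have hk : Continuous k := G.continuous_op_comp continuous_neg hf
  have hF : Continuous fun p : ℝ × ℝ => ‖C (G.op p.1 (k p.2))‖ ^ 2 :=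
    (C.continuous.comp (G.continuous_op_comp continuous_fst (hk.comp continuous_snd))).norm.pow 2
  have hpt : ∀ t ∈ Icc 0 T, ‖C (G.mild x₀ f t)‖ ^ 2 ≤ 2 * ‖C (G.op t x₀)‖ ^ 2
      + 2 * (T * ∫ s in (0 : ℝ)..T, ‖C (G.op t (k s))‖ ^ 2) := by
    intro t ht
    let _ : NormedSpace ℝ U := NormedSpace.restrictScalars ℝ 𝕜 U
    have hc : Continuous fun s => C (G.op t (k s)) :=
      C.continuous.comp ((G.op t).continuous.comp hk)
    have e : C (G.mild x₀ f t) = C (G.op t x₀) + ∫ s in (0 : ℝ)..t, C (G.op t (k s)) := by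
      have := ContinuousLinearMap.intervalIntegral_comp_comm (C.comp (G.op t))
        (hk.intervalIntegrable (μ := volume) 0 t)
      simp only [ContinuousLinearMap.comp_apply] at this
      rw [this, mild, map_add, map_add]
    have b : ‖∫ s in (0 : ℝ)..t, C (G.op t (k s))‖ ≤ ∫ s in (0 : ℝ)..T, ‖C (G.op t (k s))‖ :=
      (intervalIntegral.norm_integral_le_integral_norm ht.1).trans
        (intervalIntegral.integral_mono_interval le_rfl ht.1 ht.2
          (Eventually.of_forall fun _ => norm_nonneg _) (hc.norm.intervalIntegrable _ _))
    have b2 := (pow_le_pow_left₀ (norm_nonneg _) b 2).trans (sq_intervalIntegral_le hT hc.norm)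
    have b3 := norm_add_le (C (G.op t x₀)) (∫ s in (0 : ℝ)..t, C (G.op t (k s)))
    rw [← e] at b3
    have b4 := pow_le_pow_left₀ (norm_nonneg _) b3 2
    nlinarith [sq_nonneg (‖C (G.op t x₀)‖ - ‖∫ s in (0 : ℝ)..t, C (G.op t (k s))‖)]
  have c1 : Continuous fun t => ‖C (G.mild x₀ f t)‖ ^ 2 :=
    (C.continuous.comp (G.continuous_mild hf)).norm.pow 2
  have c2 : Continuous fun t => ‖C (G.op t x₀)‖ ^ 2 :=
    (C.continuous.comp (G.continuous_op x₀)).norm.pow 2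
  have c3 : Continuous fun t => ∫ s in (0 : ℝ)..T, ‖C (G.op t (k s))‖ ^ 2 :=
    intervalIntegral.continuous_parametric_intervalIntegral_of_continuous (s := fun _ => T)
      (f := fun t s => ‖C (G.op t (k s))‖ ^ 2) hF continuous_const
  have c4 : Continuous fun s => ∫ t in (0 : ℝ)..T, ‖C (G.op t (k s))‖ ^ 2 :=
    intervalIntegral.continuous_parametric_intervalIntegral_of_continuous (s := fun _ => T)
      (f := fun s t => ‖C (G.op t (k s))‖ ^ 2) (hF.comp continuous_swap) continuous_const
  have hswap : ∫ t in (0 : ℝ)..T, ∫ s in (0 : ℝ)..T, ‖C (G.op t (k s))‖ ^ 2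
      = ∫ s in (0 : ℝ)..T, ∫ t in (0 : ℝ)..T, ‖C (G.op t (k s))‖ ^ 2 := by
    refine intervalIntegral_intervalIntegral_swap ?_
    rw [uIoc_of_le hT.le]
    exact (hF.continuousOn.integrableOn_compact (isCompact_Icc.prod isCompact_Icc)).mono_set
      (prod_mono Ioc_subset_Icc_self Ioc_subset_Icc_self)
  calc ∫ t in (0 : ℝ)..T, ‖C (G.mild x₀ f t)‖ ^ 2
      ≤ ∫ t in (0 : ℝ)..T, (2 * ‖C (G.op t x₀)‖ ^ 2
        + 2 * (T * ∫ s in (0 : ℝ)..T, ‖C (G.op t (k s))‖ ^ 2)) :=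
        intervalIntegral.integral_mono_on hT.le (c1.intervalIntegrable _ _)
          (((c2.const_mul 2).add ((c3.const_mul T).const_mul 2)).intervalIntegrable _ _) hpt
    _ = 2 * (∫ t in (0 : ℝ)..T, ‖C (G.op t x₀)‖ ^ 2)
        + 2 * (T * ∫ s in (0 : ℝ)..T, ∫ t in (0 : ℝ)..T, ‖C (G.op t (k s))‖ ^ 2) := by
        rw [intervalIntegral.integral_add ((c2.const_mul 2).intervalIntegrable _ _)
          (((c3.const_mul T).const_mul 2).intervalIntegrable _ _),
          intervalIntegral.integral_const_mul, intervalIntegral.integral_const_mul,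
          intervalIntegral.integral_const_mul, hswap]
    _ ≤ 2 * (K * ‖D x₀‖ ^ 2) + 2 * (T * ∫ s in (0 : ℝ)..T, K * ‖D (k s)‖ ^ 2) := by
        have h1 : ∫ s in (0 : ℝ)..T, ∫ t in (0 : ℝ)..T, ‖C (G.op t (k s))‖ ^ 2
            ≤ ∫ s in (0 : ℝ)..T, K * ‖D (k s)‖ ^ 2 :=
          intervalIntegral.integral_mono_on hT.le (c4.intervalIntegrable _ _)
            ((((D.continuous.comp hk).norm.pow 2).const_mul K).intervalIntegrable _ _)
            (fun s _ => hK (k s))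
        have h2 := hK x₀
        have h3 := mul_le_mul_of_nonneg_left h1 hT.le
        linarith
    _ = _ := by rw [intervalIntegral.integral_const_mul]; ring

/-- Dominated convergence: the means converge pointwise and are uniformly bounded for lengths at
most $1$. -/
theorem tendsto_integral_norm_avg_sub_pow (S : C0Group 𝕜 H) {T : ℝ} (hT : 0 ≤ T) {k : ℝ → H}
    (hk : ContinuousOn k (Icc 0 T)) {m : ℕ} (hm : m ≠ 0) :
    Tendsto (fun n : ℕ => ∫ t in (0 : ℝ)..T, ‖S.avg ((n : ℝ) + 1)⁻¹ (k t) - k t‖ ^ m) atTop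
      (𝓝 0) := by
  obtain ⟨M, hM0, hM⟩ := S.exists_avg_bound 1
  obtain ⟨N, hN⟩ := isCompact_Icc.exists_bound_of_continuousOn hk
  have hM' : ∀ n : ℕ, ‖S.avg ((n : ℝ) + 1)⁻¹‖ ≤ M := by
    intro n
    refine hM _ ?_
    rw [abs_of_nonneg (by positivity)]
    exact inv_le_one_of_one_le₀ (by linarith [n.cast_nonneg (α := ℝ)])
  suffices h : Tendsto (fun n : ℕ => ∫ t in (0 : ℝ)..T, ‖S.avg ((n : ℝ) + 1)⁻¹ (k t) - k t‖ ^ m)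
      atTop (𝓝 (∫ t in (0 : ℝ)..T, (0 : ℝ))) by
    rwa [intervalIntegral.integral_zero] at h
  refine intervalIntegral.tendsto_integral_filter_of_dominated_convergence
    (fun _ => (M * N + N) ^ m) ?_ ?_ intervalIntegrable_const ?_
  · refine Eventually.of_forall fun n => ?_
    rw [uIoc_of_le hT]
    exact aestronglyMeasurable_of_continuousOn
      ((((S.avg _).continuous.comp_continuousOn hk).sub hk).norm.pow m)
  · refine Eventually.of_forall fun n => Eventually.of_forall fun t ht => ?_
    rw [uIoc_of_le hT] at ht
    have h1 := hN t (Ioc_subset_Icc_self ht)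
    rw [norm_pow, norm_norm]
    refine pow_le_pow_left₀ (norm_nonneg _) ?_ m
    refine (norm_sub_le _ _).trans (add_le_add ?_ h1)
    exact (ContinuousLinearMap.le_of_opNorm_le _ (hM' n) _).trans (by gcongr)
  · refine Eventually.of_forall fun t _ => ?_
    have := (tendsto_iff_norm_sub_tendsto_zero.1 (S.tendsto_seq_avg (k t))).pow m
    rwa [zero_pow hm] at this

end C0Group

variable {S : C0Group 𝕜 H}

/-- The mean of the group maps weak solutions to weak solutions. -/
theorem IsAdjWeakSol.adjAvg {T : ℝ} {g z : ℝ → H} (h : IsAdjWeakSol S T g z) (r : ℝ) :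
    IsAdjWeakSol S T (fun t => S.adjIncl (S.adjAvg r (g t)))
      (fun t => S.adjIncl (S.adjAvg r (z t))) := by
  rw [isAdjWeakSol_iff]
  refine ⟨(S.adj.avg r).continuous.comp_continuousOn h.1, fun p hp => ?_⟩
  have h1 := S.rev.mem_generatorGraph_rev hp
  rw [C0Group.rev_rev] at h1
  have h2 := S.mem_generatorGraph_rev (S.avg_map_mem_generatorGraph r h1)
  rw [map_neg, neg_neg] at h2
  have h3 := h.distribDeriv_rev h2
  simpa only [C0Group.adjIncl_adjAvg, C0Group.adj_avg, ContinuousLinearMap.adjoint_inner_right]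
    using h3

/-- Means commute with the group, so the observed curve is $e^{\mu t}B^*S(-t)^*z$, where
$z\in\mathcal D(A^*)$ is the difference of two means of $x$. The constant does not depend on the
lengths of the means, which is what yields a Cauchy sequence. -/
theorem IsAdmissible.exists_scale_observability {B : ControlOp S U} (hB : IsAdmissible S B)
    (μ : ℝ) {T : ℝ} (hT : 0 < T) :
    ∃ K : ℝ, 0 ≤ K ∧ ∀ (r r' : ℝ) (x : H),
      ∫ t in (0 : ℝ)..T, ‖((ControlOp.starL B).comp (S.adjAvg r - S.adjAvg r'))
          ((S.adj.rev.scale μ).op t x)‖ ^ 2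
        ≤ K * ‖(S.adj.avg r - S.adj.avg r') x‖ ^ 2 := by
  obtain ⟨K, hK0, hK⟩ := hB.exists_observability hT
  refine ⟨Real.exp (|μ| * T) ^ 2 * K, by positivity, fun r r' x => ?_⟩
  let z : S.adjDom := S.adjAvg r x - S.adjAvg r' x
  have hz : S.adjIncl z = (S.adj.avg r - S.adj.avg r') x := rfl
  have e : ∀ t, ((ControlOp.starL B).comp (S.adjAvg r - S.adjAvg r'))
      ((S.adj.rev.scale μ).op t x)
      = ((Real.exp (μ * t) : ℝ) : 𝕜) • ControlOp.star B (S.adjOp (-t) z) := by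
    intro t
    rw [C0Group.scale_op_apply, map_smul, ContinuousLinearMap.comp_apply, sub_apply,
      C0Group.rev_op, ← C0Group.adjOp_adjAvg, ← C0Group.adjOp_adjAvg, ControlOp.starL_apply]
    congr 2
    apply C0Group.adjDom_ext
    · exact (map_sub (S.adj.op (-t)) _ _).symm
    · exact (map_sub (S.adj.op (-t)) _ _).symm
  have hc : Continuous fun t => ControlOp.star B (S.adjOp (-t) z) :=
    (ControlOp.starL B).continuous.comp (S.continuous_adjOp continuous_neg z)
  simp only [e]
  calc _ ≤ ∫ t in (0 : ℝ)..T,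
        Real.exp (|μ| * T) ^ 2 * ‖ControlOp.star B (S.adjOp (-t) z)‖ ^ 2 := by
        refine intervalIntegral.integral_mono_on hT.le ?_ ?_ fun t ht => ?_
        · refine Continuous.intervalIntegrable ?_ _ _
          have : Continuous fun t : ℝ => ((Real.exp (μ * t) : ℝ) : 𝕜) :=
            RCLike.continuous_ofReal.comp (by fun_prop)
          exact (this.smul hc).norm.pow 2
        · exact ((hc.norm.pow 2).const_mul _).intervalIntegrable _ _
        · rw [norm_smul, RCLike.norm_ofReal, abs_of_pos (Real.exp_pos _), mul_pow]
          have : μ * t ≤ |μ| * T :=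
            (mul_le_mul_of_nonneg_right (le_abs_self μ) ht.1).trans
              (mul_le_mul_of_nonneg_left ht.2 (abs_nonneg μ))
          gcongr
    _ ≤ _ := by
        rw [intervalIntegral.integral_const_mul, ← hz, mul_assoc]
        exact mul_le_mul_of_nonneg_left (hK z) (by positivity)

/-- Mild solutions that are weak solutions have an observation. -/
theorem IsAdmissible.exists_isAdjObservation {B : ControlOp S U} (hB : IsAdmissible S B)
    (μ : ℝ) {T : ℝ} (hT : 0 < T) {g f : ℝ → H} (hg : ContinuousOn g (Icc 0 T))
    (hf : Continuous f) {x₀ : H} (hz : IsAdjWeakSol S T g ((S.adj.rev.scale μ).mild x₀ f)) :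
    ∃ v : ℝ → U, IsAdjObservation S B T g ((S.adj.rev.scale μ).mild x₀ f) v := by
  obtain ⟨K, hK0, hK⟩ := hB.exists_scale_observability μ hT
  let G := S.adj.rev.scale μ
  let z := G.mild x₀ f
  let r : ℕ → ℝ := fun n => ((n : ℝ) + 1)⁻¹
  let k : ℝ → H := fun s => G.op (-s) (f s)
  have hk : Continuous k := G.continuous_op_comp continuous_neg hf
  have hzc : Continuous z := G.continuous_mild hf
  have hZ : ∀ n, Continuous fun t => S.adjAvg (r n) (z t) := fun n =>
    (S.adjAvg (r n)).continuous.comp hzc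
  have hBZ : ∀ n, Continuous fun t => ControlOp.star B (S.adjAvg (r n) (z t)) := fun n =>
    (ControlOp.starL B).continuous.comp (hZ n)
  have hm := fun n => memLp_of_continuousOn (T := T) (p := 2) (hBZ n).continuousOn
  let vs : ℕ → Lp U 2 (volume.restrict (Ioc 0 T)) := fun n => (hm n).toLp
  -- Comparing both means with the identity doubles the constant $2K$ of the inhomogeneous estimate
  -- and splits the squared distance as $c_n+c_{n'}$.
  let c : ℕ → ℝ := fun n => 4 * K * (‖S.adj.avg (r n) x₀ - x₀‖ ^ 2
    + T * ∫ s in (0 : ℝ)..T, ‖S.adj.avg (r n) (k s) - k s‖ ^ 2)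
  have hc : Tendsto c atTop (𝓝 0) := by
    have h1 := (tendsto_iff_norm_sub_tendsto_zero.1 (S.adj.tendsto_seq_avg x₀)).pow 2
    have h2 := S.adj.tendsto_integral_norm_avg_sub_pow hT.le hk.continuousOn two_ne_zero
    have h3 := (h1.add (h2.const_mul T)).const_mul (4 * K)
    simpa using h3
  have hsq : ∀ n n' x, ‖(S.adj.avg (r n) - S.adj.avg (r n')) x‖ ^ 2
      ≤ 2 * ‖S.adj.avg (r n) x - x‖ ^ 2 + 2 * ‖S.adj.avg (r n') x - x‖ ^ 2 := by
    intro n n' x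
    have e : (S.adj.avg (r n) - S.adj.avg (r n')) x
        = (S.adj.avg (r n) x - x) - (S.adj.avg (r n') x - x) := by
      rw [sub_apply]; abel
    have := pow_le_pow_left₀ (norm_nonneg _)
      (norm_sub_le (S.adj.avg (r n) x - x) (S.adj.avg (r n') x - x)) 2
    rw [e]
    nlinarith [sq_nonneg (‖S.adj.avg (r n) x - x‖ - ‖S.adj.avg (r n') x - x‖)]
  have hdist : ∀ n n', ‖vs n - vs n'‖ ^ 2 ≤ c n + c n' := by
    intro n n'
    have e : vs n - vs n' = ((hm n).sub (hm n')).toLp := (MemLp.toLp_sub _ _).symm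
    rw [e, norm_toLp_sq hT.le]
    have h1 := G.integral_norm_sq_mild_le (x₀ := x₀)
      ((ControlOp.starL B).comp (S.adjAvg (r n) - S.adjAvg (r n')))
      (S.adj.avg (r n) - S.adj.avg (r n')) hT (hK _ _) hf
    have e2 : ∀ t, ((fun t => ControlOp.star B (S.adjAvg (r n) (z t)))
        - fun t => ControlOp.star B (S.adjAvg (r n') (z t))) t
        = ((ControlOp.starL B).comp (S.adjAvg (r n) - S.adjAvg (r n'))) (G.mild x₀ f t) := by
      intro t
      rw [ContinuousLinearMap.comp_apply, sub_apply, map_sub]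
      rfl
    simp only [e2]
    refine h1.trans ?_
    have hcc : ∀ n, Continuous fun s => ‖S.adj.avg (r n) (k s) - k s‖ ^ 2 := fun n =>
      (((S.adj.avg (r n)).continuous.comp hk).sub hk).norm.pow 2
    have h2 : ∫ s in (0 : ℝ)..T, ‖(S.adj.avg (r n) - S.adj.avg (r n')) (k s)‖ ^ 2
        ≤ 2 * (∫ s in (0 : ℝ)..T, ‖S.adj.avg (r n) (k s) - k s‖ ^ 2)
          + 2 * ∫ s in (0 : ℝ)..T, ‖S.adj.avg (r n') (k s) - k s‖ ^ 2 := by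
      rw [← intervalIntegral.integral_const_mul, ← intervalIntegral.integral_const_mul,
        ← intervalIntegral.integral_add (((hcc n).const_mul 2).intervalIntegrable _ _)
        (((hcc n').const_mul 2).intervalIntegrable _ _)]
      exact intervalIntegral.integral_mono_on hT.le
        (((((S.adj.avg (r n) - S.adj.avg (r n')).continuous.comp hk).norm.pow
          2)).intervalIntegrable _ _)
        ((((hcc n).const_mul 2).add ((hcc n').const_mul 2)).intervalIntegrable _ _)
        fun s _ => hsq n n' (k s)
    calc _ ≤ 2 * K * ((2 * ‖S.adj.avg (r n) x₀ - x₀‖ ^ 2 + 2 * ‖S.adj.avg (r n') x₀ - x₀‖ ^ 2)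
          + T * (2 * (∫ s in (0 : ℝ)..T, ‖S.adj.avg (r n) (k s) - k s‖ ^ 2)
          + 2 * ∫ s in (0 : ℝ)..T, ‖S.adj.avg (r n') (k s) - k s‖ ^ 2)) := by
          have := hsq n n' x₀
          gcongr
      _ = c n + c n' := by simp only [c]; ring
  have hcauchy : CauchySeq vs := by
    rw [Metric.cauchySeq_iff]
    intro ε hε
    obtain ⟨N, hN⟩ := eventually_atTop.1 (hc.eventually_lt_const (u := ε ^ 2 / 2) (by positivity))
    refine ⟨N, fun n hn n' hn' => ?_⟩
    rw [dist_eq_norm]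
    refine lt_of_pow_lt_pow_left₀ 2 hε.le ?_
    linarith [hdist n n', hN n hn, hN n' hn']
  obtain ⟨v, hv⟩ := cauchySeq_tendsto_of_complete hcauchy
  refine ⟨v, Lp.memLp v, fun n t => S.adjAvg (r n) (g t), fun n t => S.adjAvg (r n) (z t),
    fun n => (S.adjAvg (r n)).continuous.comp_continuousOn hg, fun n => (hZ n).continuousOn,
    fun n => hz.adjAvg (r n), ?_, ?_, ?_⟩
  · exact S.adj.tendsto_seq_avg (z 0)
  · have h1 := ENNReal.tendsto_ofReal
      (S.adj.tendsto_integral_norm_avg_sub_pow hT.le hg one_ne_zero)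
    rw [ENNReal.ofReal_zero] at h1
    refine h1.congr fun n => ?_
    simp only [pow_one]
    rw [intervalIntegral.integral_of_le hT.le, eLpNorm_one_eq_lintegral_enorm,
      ofReal_integral_norm_eq_lintegral_enorm]
    · rfl
    · exact (memLp_of_continuousOn (p := 1)
        (((S.adj.avg (r n)).continuous.comp_continuousOn hg).sub hg)).integrable le_rfl
  · rw [Lp.tendsto_Lp_iff_tendsto_eLpNorm'] at hv
    refine hv.congr fun n => eLpNorm_congr_ae ?_
    filter_upwards [(hm n).coeFn_toLp] with t ht
    rw [Pi.sub_apply, ht]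

end Existence

/-! ### The feedback system: representation, existence, uniqueness and decay -/

section Feedback

variable {𝕜 H U : Type*} [RCLike 𝕜]
  [NormedAddCommGroup H] [InnerProductSpace 𝕜 H] [CompleteSpace H]
  [NormedAddCommGroup U] [InnerProductSpace 𝕜 U] [CompleteSpace U]
  [NormedSpace ℝ H] [IsScalarTower ℝ 𝕜 H]
  {S : C0Group 𝕜 H} {B : ControlOp S U} {Q : H ≃L[𝕜] H} {W : U →L[𝕜] U} {lam lam₁ : ℝ}

theorem C0Group.scale_adj_adj (S : C0Group 𝕜 H) (μ : ℝ) : (S.adj.scale μ).adj = S.scale μ := by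
  rw [C0Group.scale_adj, C0Group.adj_adj]

theorem C0Group.rev_scale_adj (S : C0Group 𝕜 H) (μ : ℝ) :
    (S.rev.scale μ).adj = S.adj.rev.scale μ := by
  rw [C0Group.scale_adj, C0Group.rev_adj]

theorem inner_map_eq_of_isSelfAdjoint (hQ : IsSelfAdjoint (Q : H →L[𝕜] H)) (x y : H) :
    inner 𝕜 (Q x) y = inner 𝕜 x (Q y) := by
  have := ContinuousLinearMap.adjoint_inner_left (Q : H →L[𝕜] H) y x
  rwa [hQ.adjoint_eq] at this

theorem ControlOp.apply_map_eq_inner (hW : W.IsPositive) (u : U) (φ : S.adjDom) :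
    B (W u) φ = inner 𝕜 (W (ControlOp.star B φ)) u := by
  rw [hW.inner_left_eq_inner_right, ControlOp.inner_star]

/-- Representation of the solutions: `w = y - Q ỹ` solves `w' = (A - λ₁) w`, and `ỹ` solves
`ỹ' = -A* ỹ - 2 λ ỹ + λ₁ Q⁻¹ w`. -/
theorem IsFeedbackWeakSol.representation (hQ : IsSelfAdjoint (Q : H →L[𝕜] H))
    (hW : W.IsPositive) (hid : OperatorIdentity S B (Q : H →L[𝕜] H) 0 W lam) {T : ℝ} (hT : 0 < T)
    {y₀ yt₀ : H} {y yt : ℝ → H} (h : IsFeedbackWeakSol S B Q W lam lam₁ T y₀ yt₀ y yt)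
    {t : ℝ} (ht : t ∈ Icc 0 T) :
    y t - Q (yt t) = (S.scale (-lam₁)).op t (y₀ - Q yt₀) ∧
    yt t = (S.adj.rev.scale (-(2 * lam))).op t yt₀ + ∫ s in (0 : ℝ)..t,
      (S.adj.rev.scale (-(2 * lam))).op (t - s)
        ((lam₁ : 𝕜) • Q.symm ((S.scale (-lam₁)).op s (y₀ - Q yt₀))) := by
  obtain ⟨hy, rfl, rfl, hyt, v, hv, hyv⟩ := h
  have hQc : ContinuousOn (fun t => Q (yt t)) (Icc 0 T) := Q.continuous.comp_continuousOn hyt.1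
  have hw : ContinuousOn (fun t => y t - Q (yt t)) (Icc 0 T) := hy.sub hQc
  have hg1 : ContinuousOn (fun t => (lam₁ : 𝕜) • Q.symm (y t - Q (yt t))) (Icc 0 T) :=
    (Q.symm.continuous.comp_continuousOn hw).const_smul _
  have hg : ContinuousOn (fun t => -(((2 * lam : ℝ) : 𝕜) • yt t)
      + (lam₁ : 𝕜) • Q.symm (y t - Q (yt t))) (Icc 0 T) := (hyt.1.const_smul _).neg.add hg1
  have hwt : ∀ t ∈ Icc 0 T, y t - Q (yt t) = (S.scale (-lam₁)).op t (y 0 - Q (yt 0)) := by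
    intro t ht
    -- The curve $w$ is tested against the domain of $A^*-\lambda_1$, generator of the rescaled
    -- adjoint group, and the source is zero.
    have key := (S.adj.scale (-lam₁)).duhamel_of_weak hT (z := fun t => y t - Q (yt t))
      (g := fun _ => 0) hw continuousOn_const (fun p hp => by
        have h1 := S.adj.mem_generatorGraph_of_scale (-lam₁) hp
        let φ : S.adjDom := ⟨_, (S.mem_adjDom_iff_mem_generatorGraph _ _).2 h1⟩
        have e1 : S.adjIncl φ = p.1 := rfl
        have e2 : S.adjGen φ = p.2 - ((-lam₁ : ℝ) : 𝕜) • p.1 := rfl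
        have d1 := hv.distribDeriv hid hT hg hyt φ
        have d2 := hyv φ
        have i1 : IntervalIntegrable
            (fun t => inner 𝕜 (W (ControlOp.star B φ)) (v t)) volume 0 T := by
          rw [intervalIntegrable_iff_integrableOn_Ioc_of_le hT.le]
          exact ((innerSL 𝕜 (W (ControlOp.star B φ))).comp_memLp' hv.1).integrable (by norm_num)
        have i2 : IntervalIntegrable (fun t => B (W (v t)) φ) volume 0 T := by
          simpa only [ControlOp.apply_map_eq_inner hW] using i1
        have c1 : ContinuousOn (fun t => inner 𝕜 (S.adjGen φ) (Q (yt t))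
            + ((2 * lam : ℝ) : 𝕜) * inner 𝕜 (Q (S.adjIncl φ)) (yt t)
            + inner 𝕜 (Q (S.adjIncl φ)) (-(((2 * lam : ℝ) : 𝕜) • yt t)
              + (lam₁ : 𝕜) • Q.symm (y t - Q (yt t)))) (Icc 0 T) :=
          ((continuousOn_const.inner hQc).add
            (continuousOn_const.mul (continuousOn_const.inner hyt.1))).add
            (continuousOn_const.inner hg)
        have c2 : ContinuousOn (fun t => inner 𝕜 (S.adjGen φ) (y t)) (Icc 0 T) :=
          continuousOn_const.inner hy
        -- Subtracting the equation for $Q\tilde y$ from that for $y$ cancels the observation terms,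
        -- as both contain the same $v$.
        have d3 := d2.sub
          ((continuousOn_const.inner hy).intervalIntegrable_of_Icc hT.le)
          ((continuousOn_const.inner hyt.1).intervalIntegrable_of_Icc hT.le)
          ((c2.intervalIntegrable_of_Icc hT.le).sub i2)
          ((c1.intervalIntegrable_of_Icc hT.le).sub i1) d1
        refine d3.congr hT.le (fun t _ => ?_) (fun t _ => ?_)
        · rw [inner_sub_right, e1, ContinuousLinearEquiv.coe_coe,
            inner_map_eq_of_isSelfAdjoint hQ]
        · rw [ControlOp.apply_map_eq_inner hW, inner_zero_right, add_zero, inner_add_right,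
            inner_neg_right, inner_smul_right, inner_smul_right,
            inner_map_eq_of_isSelfAdjoint hQ _ (Q.symm _),
            ContinuousLinearEquiv.apply_symm_apply, e1, e2, inner_sub_left, inner_sub_left,
            inner_smul_left, inner_smul_left, RCLike.conj_ofReal, inner_sub_right,
            inner_sub_right]
          push_cast
          ring) ht
    rw [C0Group.scale_adj_adj] at key
    simpa using key
  refine ⟨hwt t ht, ?_⟩
  -- The damping $-2\lambda\tilde y$ is absorbed into the rescaled group $e^{-2\lambda t}S(-t)^*$,
  -- which leaves only the known source $\lambda_1Q^{-1}w$.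
  have key := (S.rev.scale (-(2 * lam))).duhamel_of_weak hT (z := yt)
    (g := fun t => (lam₁ : 𝕜) • Q.symm (y t - Q (yt t))) hyt.1 hg1 (fun p hp => by
      have h1 := S.rev.mem_generatorGraph_of_scale (-(2 * lam)) hp
      refine (hyt.distribDeriv_rev h1).congr hT.le (fun _ _ => rfl) fun t _ => ?_
      simp only
      rw [inner_add_right, inner_neg_right, inner_sub_left, inner_smul_left, inner_smul_right,
        RCLike.conj_ofReal]
      push_cast
      ring) ht
  rw [C0Group.rev_scale_adj] at key
  rw [key]
  congr 1
  refine intervalIntegral.integral_congr fun s hs => ?_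
  rw [uIcc_of_le ht.1] at hs
  simp only [hwt s ⟨hs.1, hs.2.trans ht.2⟩]

/-- Define $w$ and $\tilde y$ by the representation formulas and put $y=w+Q\tilde y$. Admissibility
supplies the observation of $\tilde y$, and adding the equations of $w$ and $Q\tilde y$ gives that
of $y$. -/
theorem exists_isGlobalFeedbackWeakSol (hB : IsAdmissible S B)
    (hQ : IsSelfAdjoint (Q : H →L[𝕜] H))
    (hW : W.IsPositive) (hid : OperatorIdentity S B (Q : H →L[𝕜] H) 0 W lam) (y₀ yt₀ : H) :
    ∃ y yt : ℝ → H, IsGlobalFeedbackWeakSol S B Q W lam lam₁ y₀ yt₀ y yt := by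
  let w : ℝ → H := fun t => (S.scale (-lam₁)).op t (y₀ - Q yt₀)
  let f : ℝ → H := fun t => (lam₁ : 𝕜) • Q.symm (w t)
  let yt : ℝ → H := (S.adj.rev.scale (-(2 * lam))).mild yt₀ f
  have hw : Continuous w := (S.scale (-lam₁)).continuous_op _
  have hf : Continuous f := (Q.symm.continuous.comp hw).const_smul _
  have hyt : Continuous yt := C0Group.continuous_mild _ hf
  have hQyt : Continuous fun t => Q (yt t) := Q.continuous.comp hyt
  let y : ℝ → H := fun t => w t + Q (yt t)
  have hy : Continuous y := hw.add hQyt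
  have e0 : yt 0 = yt₀ := C0Group.mild_zero _
  refine ⟨y, yt, fun T hT => ?_⟩
  let g : ℝ → H := fun t => -(((2 * lam : ℝ) : 𝕜) • yt t) + (lam₁ : 𝕜) • Q.symm (y t - Q (yt t))
  have hgf : ∀ t, g t = -(((2 * lam : ℝ) : 𝕜) • yt t) + f t := by
    intro t; simp only [g, y, f, add_sub_cancel_right]
  have hg : Continuous g := by
    rw [funext hgf]
    exact (hyt.const_smul _).neg.add hf
  have hsol : IsAdjWeakSol S T g yt := by
    rw [isAdjWeakSol_iff]
    refine ⟨hyt.continuousOn, fun p hp => ?_⟩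
    refine DistribDeriv.of_hasDerivAt hT.le (continuousOn_const.inner hyt.continuousOn)
      (fun t _ => ?_) (((continuous_const.inner hyt).add
        (continuous_const.inner hg)).intervalIntegrable _ _)
    have := (S.rev.scale (-(2 * lam))).hasDerivAt_inner_mild (x₀ := yt₀) hf
      (S.rev.mem_generatorGraph_scale (-(2 * lam)) hp) t
    rw [C0Group.rev_scale_adj] at this
    convert this using 1
    rw [hgf]
    change inner 𝕜 p.2 (yt t) + _ = inner 𝕜 _ (yt t) + _
    rw [inner_add_right, inner_neg_right, inner_add_left, inner_smul_left, inner_smul_right,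
      RCLike.conj_ofReal]
    push_cast
    ring
  obtain ⟨v, hv⟩ := hB.exists_isAdjObservation (-(2 * lam)) hT hg.continuousOn hf hsol
  refine ⟨hy.continuousOn, ?_, e0, hsol, v, hv, fun φ => ?_⟩
  · change w 0 + Q (yt 0) = y₀
    rw [e0]
    simp [w, C0Group.op_zero_apply]
  · have d1 := hv.distribDeriv hid hT hg.continuousOn hsol φ
    have hφ := S.adj.mem_generatorGraph_scale (-lam₁) (S.adjDom_mem_generatorGraph φ)
    have hmild : ∀ t, (S.adj.scale (-lam₁)).adj.mild (y₀ - Q yt₀) (fun _ => 0) t = w t := by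
      intro t
      rw [C0Group.scale_adj_adj]
      simp [C0Group.mild, w]
    have cw : Continuous fun t => inner 𝕜 (S.adjGen φ + ((-lam₁ : ℝ) : 𝕜) • S.adjIncl φ) (w t) :=
      continuous_const.inner hw
    have d2 : DistribDeriv T (fun t => inner 𝕜 (S.adjIncl φ) (w t))
        (fun t => inner 𝕜 (S.adjGen φ + ((-lam₁ : ℝ) : 𝕜) • S.adjIncl φ) (w t)) := by
      refine DistribDeriv.of_hasDerivAt hT.le (continuousOn_const.inner hw.continuousOn)
        (fun t _ => ?_) (cw.intervalIntegrable _ _)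
      have := (S.adj.scale (-lam₁)).hasDerivAt_inner_mild (x₀ := y₀ - Q yt₀)
        (f := fun _ => 0) continuous_const hφ t
      simpa only [hmild, inner_zero_right, add_zero] using this
    have i1 : IntervalIntegrable
        (fun t => inner 𝕜 (W (ControlOp.star B φ)) (v t)) volume 0 T := by
      rw [intervalIntegrable_iff_integrableOn_Ioc_of_le hT.le]
      exact ((innerSL 𝕜 (W (ControlOp.star B φ))).comp_memLp' hv.1).integrable (by norm_num)
    have c1 : Continuous (fun t => inner 𝕜 (S.adjGen φ) (Q (yt t))
        + ((2 * lam : ℝ) : 𝕜) * inner 𝕜 (Q (S.adjIncl φ)) (yt t)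
        + inner 𝕜 (Q (S.adjIncl φ)) (g t)) :=
      ((continuous_const.inner hQyt).add
        (continuous_const.mul (continuous_const.inner hyt))).add (continuous_const.inner hg)
    have d3 := d2.add ((continuous_const.inner hw).intervalIntegrable _ _)
      ((continuous_const.inner hyt).intervalIntegrable _ _) (cw.intervalIntegrable _ _)
      ((c1.intervalIntegrable _ _).sub i1) d1
    refine d3.congr hT.le (fun t _ => ?_) (fun t _ => ?_)
    · change _ = inner 𝕜 _ (w t + Q (yt t))
      rw [inner_add_right, ContinuousLinearEquiv.coe_coe, inner_map_eq_of_isSelfAdjoint hQ]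
    · change _ = inner 𝕜 _ (w t + Q (yt t)) - _
      have hgt : inner 𝕜 (Q (S.adjIncl φ)) (g t)
          = -(((2 * lam : ℝ) : 𝕜) * inner 𝕜 (Q (S.adjIncl φ)) (yt t))
            + (lam₁ : 𝕜) * inner 𝕜 (S.adjIncl φ) (w t) := by
        rw [hgf, inner_add_right, inner_neg_right, inner_smul_right]
        congr 1
        rw [inner_smul_right, inner_map_eq_of_isSelfAdjoint hQ,
          ContinuousLinearEquiv.apply_symm_apply]
      rw [hgt,
        ControlOp.apply_map_eq_inner hW, inner_add_right, inner_add_left, inner_smul_left,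
        RCLike.conj_ofReal]
      push_cast
      ring

theorem IsFeedbackWeakSol.unique (hQ : IsSelfAdjoint (Q : H →L[𝕜] H))
    (hW : W.IsPositive) (hid : OperatorIdentity S B (Q : H →L[𝕜] H) 0 W lam) {T : ℝ} (hT : 0 < T)
    {y₀ yt₀ : H} {y yt x xt : ℝ → H} (h : IsFeedbackWeakSol S B Q W lam lam₁ T y₀ yt₀ y yt)
    (h' : IsFeedbackWeakSol S B Q W lam lam₁ T y₀ yt₀ x xt) :
    EqOn y x (Icc 0 T) ∧ EqOn yt xt (Icc 0 T) := by
  have h2 : EqOn yt xt (Icc 0 T) := fun t ht =>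
    (h.representation hQ hW hid hT ht).2.trans (h'.representation hQ hW hid hT ht).2.symm
  refine ⟨fun t ht => ?_, h2⟩
  have := (h.representation hQ hW hid hT ht).1.trans (h'.representation hQ hW hid hT ht).1.symm
  rw [h2 ht] at this
  exact sub_left_injective this

theorem intervalIntegral_exp_le {δ t : ℝ} (hδ : δ < 0) :
    ∫ s in (0 : ℝ)..t, Real.exp (δ * s) ≤ (-δ)⁻¹ := by
  rw [intervalIntegral.integral_comp_mul_left (fun s => Real.exp s) hδ.ne, integral_exp,
    mul_zero, Real.exp_zero, smul_eq_mul, inv_neg]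
  have h1 := Real.exp_pos (δ * t)
  have h2 := inv_lt_zero.2 hδ
  nlinarith

/-- The curve $w$ has rate $b=\omega_A-\lambda_1$ and the free part of $\tilde y$ has rate
$a=\omega_A'-2\lambda$. The hypothesis is exactly $b<a$, so in Duhamel's integral
$e^{a(t-s)}e^{bs}=e^{at}e^{(b-a)s}$ contributes at most $e^{at}/(a-b)$. -/
theorem exists_decay (hQ : IsSelfAdjoint (Q : H →L[𝕜] H))
    (hW : W.IsPositive) (hid : OperatorIdentity S B (Q : H →L[𝕜] H) 0 W lam) {ωA ωA' c : ℝ}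
    (hc : 0 < c) (h1 : ∀ t : ℝ, 0 ≤ t → ‖S.op t‖ ≤ c * Real.exp (t * ωA))
    (h2 : ∀ t : ℝ, 0 ≤ t → ‖(S.op (-t)).adjoint‖ ≤ c * Real.exp (t * ωA'))
    (hω : ωA - ωA' < lam₁ - 2 * lam) :
    ∃ C : ℝ, 0 < C ∧ ∀ (y₀ yt₀ : H) (y yt : ℝ → H),
      IsGlobalFeedbackWeakSol S B Q W lam lam₁ y₀ yt₀ y yt →
      ∀ t : ℝ, 0 ≤ t →
        ‖y t‖ + ‖yt t‖ ≤ C * Real.exp ((ωA' - 2 * lam) * t) * (‖y₀‖ + ‖yt₀‖) := by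
  set q := ‖(Q : H →L[𝕜] H)‖ with hq
  set r := ‖(Q.symm : H →L[𝕜] H)‖ with hr
  set a := ωA' - 2 * lam with ha
  set b := ωA - lam₁ with hb
  have hq0 : 0 ≤ q := norm_nonneg _
  have hr0 : 0 ≤ r := norm_nonneg _
  have hδ : b - a < 0 := by linarith
  have hδ0 : 0 ≤ (-(b - a))⁻¹ := inv_nonneg.2 (by linarith)
  set D := c + c ^ 2 * |lam₁| * r * (-(b - a))⁻¹ * (1 + q) with hD
  have hD0 : 0 < D := by positivity
  -- The first term bounds $w$ and $D$ bounds $\tilde y$; they combine through $\|y\|+\|\tilde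
  -- y\|\le\|w\|+(1+q)\|\tilde y\|$.
  refine ⟨c * (1 + q) + (1 + q) * D, by positivity, fun y₀ yt₀ y yt h t ht => ?_⟩
  -- The horizon $t+1$ is positive even when $t=0$.
  obtain ⟨e1, e2⟩ := (h (t + 1) (by linarith)).representation hQ hW hid (by linarith)
    (t := t) ⟨ht, by linarith⟩
  set E := ‖y₀‖ + ‖yt₀‖ with hE
  have hE0 : 0 ≤ E := by positivity
  have hy0 : ‖y₀‖ ≤ E := by simp [hE]
  have hyt0 : ‖yt₀‖ ≤ E := by simp [hE]
  set w₀ := y₀ - Q yt₀ with hw₀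
  have hw0 : ‖w₀‖ ≤ (1 + q) * E := by
    have h3 : ‖Q yt₀‖ ≤ q * ‖yt₀‖ := (Q : H →L[𝕜] H).le_opNorm yt₀
    have h4 : q * ‖yt₀‖ ≤ q * E := mul_le_mul_of_nonneg_left hyt0 hq0
    linarith [norm_sub_le y₀ (Q yt₀)]
  have hS : ∀ s, 0 ≤ s → ‖(S.scale (-lam₁)).op s w₀‖ ≤ c * Real.exp (b * s) * ((1 + q) * E) := by
    intro s hs
    rw [C0Group.norm_scale_op_apply]
    calc _ ≤ Real.exp (-lam₁ * s) * (c * Real.exp (s * ωA) * ((1 + q) * E)) := by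
          gcongr
          exact ((S.op s).le_of_opNorm_le (h1 s hs) _).trans (by gcongr)
      _ = c * (Real.exp (-lam₁ * s) * Real.exp (s * ωA)) * ((1 + q) * E) := by ring
      _ = _ := by rw [← Real.exp_add]; congr 3; rw [hb]; ring
  have hG : ∀ s x, 0 ≤ s → ‖(S.adj.rev.scale (-(2 * lam))).op s x‖
      ≤ c * Real.exp (a * s) * ‖x‖ := by
    intro s x hs
    rw [C0Group.norm_scale_op_apply]
    calc _ ≤ Real.exp (-(2 * lam) * s) * (c * Real.exp (s * ωA') * ‖x‖) := by
          gcongr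
          exact ContinuousLinearMap.le_of_opNorm_le _ (h2 s hs) _
      _ = c * (Real.exp (-(2 * lam) * s) * Real.exp (s * ωA')) * ‖x‖ := by ring
      _ = _ := by rw [← Real.exp_add]; congr 3; rw [ha]; ring
  have hI : ‖∫ s in (0 : ℝ)..t, (S.adj.rev.scale (-(2 * lam))).op (t - s)
      ((lam₁ : 𝕜) • Q.symm ((S.scale (-lam₁)).op s w₀))‖
      ≤ c ^ 2 * |lam₁| * r * ((1 + q) * E) * Real.exp (a * t) * (-(b - a))⁻¹ := by
    calc _ ≤ ∫ s in (0 : ℝ)..t, c ^ 2 * |lam₁| * r * ((1 + q) * E) * Real.exp (a * t)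
            * Real.exp ((b - a) * s) := by
          refine intervalIntegral.norm_integral_le_of_norm_le ht
            (Eventually.of_forall fun s hs => ?_)
            ((by fun_prop : Continuous fun s => c ^ 2 * |lam₁| * r * ((1 + q) * E)
              * Real.exp (a * t) * Real.exp ((b - a) * s)).intervalIntegrable _ _)
          have h3 : ‖(lam₁ : 𝕜) • Q.symm ((S.scale (-lam₁)).op s w₀)‖
              ≤ |lam₁| * (r * (c * Real.exp (b * s) * ((1 + q) * E))) := by
            rw [norm_smul, RCLike.norm_ofReal]
            gcongr
            exact ((Q.symm : H →L[𝕜] H).le_opNorm _).trans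
              (mul_le_mul_of_nonneg_left (hS s hs.1.le) hr0)
          calc _ ≤ c * Real.exp (a * (t - s))
                * (|lam₁| * (r * (c * Real.exp (b * s) * ((1 + q) * E)))) :=
                (hG _ _ (by linarith [hs.2])).trans (by gcongr)
            _ = c ^ 2 * |lam₁| * r * ((1 + q) * E)
                * (Real.exp (a * (t - s)) * Real.exp (b * s)) := by ring
            _ = _ := by
                rw [← Real.exp_add, mul_assoc _ (Real.exp _) (Real.exp _), ← Real.exp_add]
                congr 2; ring
      _ ≤ _ := by
          rw [intervalIntegral.integral_const_mul]
          exact mul_le_mul_of_nonneg_left (intervalIntegral_exp_le hδ) (by positivity)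
  have hyt : ‖yt t‖ ≤ D * E * Real.exp (a * t) := by
    rw [e2]
    have h3 := hG t yt₀ ht
    have h4 : c * Real.exp (a * t) * ‖yt₀‖ ≤ c * Real.exp (a * t) * E := by gcongr
    refine (norm_add_le _ _).trans ((add_le_add (h3.trans h4) hI).trans (le_of_eq ?_))
    rw [hD]; ring
  have hwt : ‖y t - Q (yt t)‖ ≤ c * (1 + q) * E * Real.exp (a * t) := by
    rw [e1]
    refine (hS t ht).trans ?_
    have h3 : Real.exp (b * t) ≤ Real.exp (a * t) := by
      gcongr; linarith
    calc _ ≤ c * Real.exp (a * t) * ((1 + q) * E) := by gcongr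
      _ = _ := by ring
  have hy : ‖y t‖ ≤ ‖y t - Q (yt t)‖ + q * ‖yt t‖ := by
    have h3 := norm_add_le (y t - Q (yt t)) (Q (yt t))
    rw [sub_add_cancel] at h3
    have h4 : ‖Q (yt t)‖ ≤ q * ‖yt t‖ := (Q : H →L[𝕜] H).le_opNorm _
    linarith
  have h5 := mul_le_mul_of_nonneg_left hyt (by positivity : 0 ≤ 1 + q)
  linarith

/-- Skew-adjointness makes the derivative of $\|S(s)x\|^2$ vanish for $x\in\mathcal D(A)$. Means
carry the bound over to all of $\mathbb H$. -/
theorem C0Group.norm_op_le_one (hA : S.generator.adjoint = -S.generator) (t : ℝ) :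
    ‖S.op t‖ ≤ 1 := by
  have key : ∀ p ∈ S.generatorGraph, ‖S.op t p.1‖ = ‖p.1‖ := by
    intro p hp
    have hz : ∀ s, inner 𝕜 (S.op s p.1) (S.op s p.2) + inner 𝕜 (S.op s p.2) (S.op s p.1) = 0 := by
      intro s
      have h1 := S.op_mem_generatorGraph s hp
      have h2 : WithLp.toLp 2 (S.op s p.1, -S.op s p.2) ∈ S.adjDom := by
        change (S.op s p.1, -S.op s p.2) ∈ S.generator.adjoint.graph
        have h3 := h1
        rw [hA, LinearPMap.neg_graph]
        rw [← C0Group.generator_graph] at h3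
        exact ⟨_, h3, by simp⟩
      have h3 := S.inner_generator_adjDom ⟨_, h2⟩ h1
      change inner 𝕜 (S.op s p.2) (S.op s p.1) = inner 𝕜 (S.op s p.1) (-S.op s p.2) at h3
      rw [h3, inner_neg_right, add_neg_cancel]
    have hd : ∀ s, HasDerivAt (fun s => inner 𝕜 (S.op s p.1) (S.op s p.1)) 0 s := by
      intro s
      have := (S.hasDerivAt_op hp s).inner 𝕜 (S.hasDerivAt_op hp s)
      rwa [hz] at this
    have h4 := is_const_of_deriv_eq_zero (fun s => (hd s).differentiableAt)
      (fun s => (hd s).deriv) t 0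
    simp only [S.op_zero_apply, inner_self_eq_norm_sq_to_K] at h4
    have h5 : ‖S.op t p.1‖ ^ 2 = ‖p.1‖ ^ 2 := by exact_mod_cast h4
    exact (sq_eq_sq₀ (norm_nonneg _) (norm_nonneg _)).1 h5
  refine ContinuousLinearMap.opNorm_le_bound _ zero_le_one fun x => ?_
  rw [one_mul]
  refine le_of_tendsto_of_tendsto (((S.op t).continuous.tendsto _).comp (S.tendsto_avg x)).norm
    (S.tendsto_avg x).norm (Eventually.of_forall fun h => ?_)
  exact (key _ (S.avg_mem_generatorGraph h x)).le

end Feedback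

end

theorem mainTheorem2 {𝕜 H U : Type*} [RCLike 𝕜]
    [NormedAddCommGroup H] [InnerProductSpace 𝕜 H] [CompleteSpace H]
    [NormedAddCommGroup U] [InnerProductSpace 𝕜 U] [CompleteSpace U]
    (S : C0Group 𝕜 H) (B : ControlOp S U) (hB : IsAdmissible S B)
    (Q : H ≃L[𝕜] H) (hQ : IsSymmCoercive (Q : H →L[𝕜] H))
    (W : U →L[𝕜] U) (hW : W.IsPositive)
    (lam lam₁ : ℝ) (hid : OperatorIdentity S B (Q : H →L[𝕜] H) 0 W lam) :
    -- existence and uniqueness of weak solutions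
    (∀ y₀ yt₀ : H,
      (∃ y yt : ℝ → H, IsGlobalFeedbackWeakSol S B Q W lam lam₁ y₀ yt₀ y yt) ∧
      (∀ T : ℝ, 0 < T → ∀ y yt x xt : ℝ → H,
        IsFeedbackWeakSol S B Q W lam lam₁ T y₀ yt₀ y yt →
        IsFeedbackWeakSol S B Q W lam lam₁ T y₀ yt₀ x xt →
        Set.EqOn y x (Set.Icc 0 T) ∧ Set.EqOn yt xt (Set.Icc 0 T))) ∧
    -- decay of the solutions
    (∀ ωA ωA' c : ℝ, 0 < c →
      (∀ t : ℝ, 0 ≤ t → ‖S.op t‖ ≤ c * Real.exp (t * ωA)) →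
      (∀ t : ℝ, 0 ≤ t → ‖(S.op (-t)).adjoint‖ ≤ c * Real.exp (t * ωA')) →
      ωA - ωA' < lam₁ - 2 * lam →
      ∃ C : ℝ, 0 < C ∧ ∀ (y₀ yt₀ : H) (y yt : ℝ → H),
        IsGlobalFeedbackWeakSol S B Q W lam lam₁ y₀ yt₀ y yt →
        ∀ t : ℝ, 0 ≤ t →
          ‖y t‖ + ‖yt t‖ ≤ C * Real.exp ((ωA' - 2 * lam) * t) * (‖y₀‖ + ‖yt₀‖)) ∧
    -- the skew-adjoint case
    (S.generator.adjoint = -S.generator → 2 * lam < lam₁ →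
      ∃ C : ℝ, 0 < C ∧ ∀ (y₀ yt₀ : H) (y yt : ℝ → H),
        IsGlobalFeedbackWeakSol S B Q W lam lam₁ y₀ yt₀ y yt →
        ∀ t : ℝ, 0 ≤ t →
          ‖y t‖ + ‖yt t‖ ≤ C * Real.exp (-(2 * lam) * t) * (‖y₀‖ + ‖yt₀‖)) := by
  let _ : NormedSpace ℝ H := NormedSpace.restrictScalars ℝ 𝕜 H
  have _ : IsScalarTower ℝ 𝕜 H := IsScalarTower.of_algebraMap_smul fun _ _ => rfl
  refine ⟨fun y₀ yt₀ => ⟨exists_isGlobalFeedbackWeakSol hB hQ.1 hW hid y₀ yt₀,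
    fun T hT y yt x xt h h' => h.unique hQ.1 hW hid hT h'⟩,
    fun ωA ωA' c hc h1 h2 hω => exists_decay hQ.1 hW hid hc h1 h2 hω, fun hA hlam => ?_⟩
  -- In the skew-adjoint case both evolutions are contractive: the general decay applies with both
  -- growth rates $0$ and $c=1$.
  obtain ⟨C, hC, h⟩ := exists_decay (S := S) (B := B) (lam := lam) (lam₁ := lam₁) hQ.1 hW hid
    (ωA := 0) (ωA' := 0) one_pos (fun t _ => by simpa using C0Group.norm_op_le_one hA t)
    (fun t _ => by
      rw [LinearIsometryEquiv.norm_map]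
      simpa using C0Group.norm_op_le_one hA (-t)) (by linarith)
  refine ⟨C, hC, fun y₀ yt₀ y yt hy t ht => ?_⟩
  simpa using h y₀ yt₀ y yt hy t ht
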